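/- **Setting.** A Bayesian principal-agent instance consists of a set $\Theta$ of $\ell$ agent's types, a set $A$ of $n$ actions and a set $\Omega$ of $m$ outcomes (all finite), a probability distribution $\mu$ on $\Theta$, a probability distribution $F_{\theta,a}$ on $\Omega$ and a cost $c_{\theta,a}\in[0,1]$ for every $\theta\in\Theta$, $a\in A$, and rewards $r_\omega\in[0,1]$ for $\omega\in\Omega$; some action has cost $0$ for every type. A contract is a vector $p\in\mathbb{R}_{\ge 0}^{\Omega}$ of payments. Under $p$, an action $a$ gives an agent of type $\theta$ the utility $\sum_\omega F_{\theta,a,\omega}p_\omega-c_{\theta,a}$ and the principal the utility $\sum_\omega F_{\theta,a,\omega}(r_\omega-p_\omega)$. An action is incentive compatible (IC) for $\theta$ if it maximizes the agent's utility over $A$; type $\theta$ plays an IC action $a^\ast(\theta)$ that is best for the principal among the IC actions. A contract is optimal if it maximizes $\sum_\theta\mu_\theta\sum_\omega F_{\theta,a^\ast(\theta),\omega}(r_\omega-p_\omega)$ over all contracts. For $\mathbf a=(a_\theta)_{\theta\in\Theta}\in A^\Theta$ let $P(\mathbf a)$ be the polyhedron of all contracts under which $a_\theta$ is IC for every $\theta\in\Theta$,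 and let $P^\star=\bigcup_{\mathbf a}\mathcal V(P(\mathbf a))$ be the set of all vertices (extreme points) of these polyhedra. **Theorem.** 1. There is an algorithm that, given any Bayesian principal-agent instance, finds an optimal contract in time polynomial in $n^m$ and $\ell^m$. Precisely: there are a single program for the real random access machine (a machine that stores integers and real numbers, has indirect addressing by integers, adds, subtracts, multiplies, divides and compares integers and real numbers exactly, uses only rational constants, and is charged one step for every operation, memory access and test), a polynomial $T$ in two variables and a polynomial $Q$ in three variables, with natural-number coefficients, such that for every instance, held in memory at the start, the program halts after at most $T(n^m,\ell^m)$ steps with an optimal contract in memory, and every integer that it computes is at most $T(n^m,\ell^m)$. Moreover, if all the numbers $\mu_\theta$, $F_{\theta,a,\omega}$, $c_{\theta,a}$, $r_\omega$ are rational with numerators and denominators of at most $B$ binary digits, then every number that the program writes in this run is rational with numerator and denominator of at most $Q(n^m,\ell^m,B)$ binary digits. 2. For every Bayesian principal-agent instance, some element of $P^\star$ is an optimal contract, and $P^\star$ is a finite set with at most $\binom{\ell n^2+m}{m}$ elements. -/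

import Mathlib

namespace BayesianPA

/-! ### Bayesian principal-agent problems -/

/-- A Bayesian principal-agent instance with `ℓ` types, `n` actions and `m` outcomes. -/
structure Setting (ℓ n m : ℕ) where
  /-- the distribution of the agent's type -/
  μ : Fin ℓ → ℝ
  /-- `F θ a ω` is the probability of outcome `ω` when type `θ` takes action `a` -/
  F : Fin ℓ → Fin n → Fin m → ℝ
  /-- `c θ a` is the cost of action `a` for type `θ` -/
  c : Fin ℓ → Fin n → ℝ
  /-- `r ω` is the principal's reward for outcome `ω` -/
  r : Fin m → ℝ
  μ_mem : μ ∈ stdSimplex ℝ (Fin ℓ)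
  F_mem : ∀ θ a, F θ a ∈ stdSimplex ℝ (Fin m)
  c_mem : ∀ θ a, c θ a ∈ Set.Icc (0 : ℝ) 1
  r_mem : ∀ ω, r ω ∈ Set.Icc (0 : ℝ) 1
  /-- some action is free of cost for every type -/
  exists_free : ∃ a, ∀ θ, c θ a = 0

namespace Setting

variable {ℓ n m : ℕ} (I : Setting ℓ n m)

/-- The expected reward `R_{θ,a}`. -/
def reward (θ : Fin ℓ) (a : Fin n) : ℝ := ∑ ω, I.F θ a ω * I.r ω

/-- The expected payment `P_{θ,a}` under the contract `p`. -/
def payment (p : Fin m → ℝ) (θ : Fin ℓ) (a : Fin n) : ℝ := ∑ ω, I.F θ a ω * p ω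

/-- The agent's expected utility. -/
def agentUtility (p : Fin m → ℝ) (θ : Fin ℓ) (a : Fin n) : ℝ := I.payment p θ a - I.c θ a

/-- The principal's expected utility when type `θ` takes action `a`. -/
def principalUtility (p : Fin m → ℝ) (θ : Fin ℓ) (a : Fin n) : ℝ :=
  I.reward θ a - I.payment p θ a

/-- Action `a` is incentive compatible for type `θ` under `p`. -/
def IC (p : Fin m → ℝ) (θ : Fin ℓ) (a : Fin n) : Prop :=
  ∀ a', I.agentUtility p θ a' ≤ I.agentUtility p θ a

/-- Under limited liability, an incentive compatible action is individually rational. -/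
theorem IC.individuallyRational {I : Setting ℓ n m} {p : Fin m → ℝ} (hp : ∀ ω, 0 ≤ p ω)
    {θ : Fin ℓ} {a : Fin n} (h : I.IC p θ a) : 0 ≤ I.agentUtility p θ a := by
  obtain ⟨a₀, h₀⟩ := I.exists_free
  refine le_trans ?_ (h a₀)
  simp only [agentUtility, h₀, sub_zero, payment]
  exact Finset.sum_nonneg fun ω _ => mul_nonneg ((I.F_mem θ a₀).1 ω) (hp ω)

/-- The contract `p` implements `a` for type `θ`: the action `a` is incentive compatible, and ties
are broken in favour of the principal. -/
def Implements (p : Fin m → ℝ) (θ : Fin ℓ) (a : Fin n) : Prop :=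
  I.IC p θ a ∧ ∀ a', I.IC p θ a' → I.principalUtility p θ a' ≤ I.principalUtility p θ a

/-- The principal's overall expected utility when type `θ` takes action `a θ`. -/
def overallUtility (p : Fin m → ℝ) (a : Fin ℓ → Fin n) : ℝ :=
  ∑ θ, I.μ θ * I.principalUtility p θ (a θ)

/-- `p` is an optimal contract: its payments are nonnegative, and no contract with nonnegative
payments gives the principal more, the agent's types taking the actions that the respective
contract implements. -/
def IsOptimal (p : Fin m → ℝ) : Prop :=
  (∀ ω, 0 ≤ p ω) ∧ ∃ a : Fin ℓ → Fin n, (∀ θ, I.Implements p θ (a θ)) ∧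
    ∀ q : Fin m → ℝ, (∀ ω, 0 ≤ q ω) → ∀ b : Fin ℓ → Fin n, (∀ θ, I.Implements q θ (b θ)) →
      I.overallUtility q b ≤ I.overallUtility p a

/-- The polyhedron `P(𝐚)` of contracts under which `a θ` is incentive compatible for each `θ`. -/
def profilePolytope (a : Fin ℓ → Fin n) : Set (Fin m → ℝ) :=
  {p | (∀ ω, 0 ≤ p ω) ∧ ∀ θ, I.IC p θ (a θ)}

/-- The set of the vertices of all the polyhedra `P(𝐚)`. -/
def candidates : Set (Fin m → ℝ) :=
  ⋃ a : Fin ℓ → Fin n, Set.extremePoints ℝ (I.profilePolytope a)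

end Setting

/-! ### The machine model

A real random access machine, programmed in a structured language.  There are two kinds of memory
cells: words (natural numbers, used for indices and control) and numbers (reals).  Each kind of
memory consists of arrays; the name of an array is fixed in the program, the address within the
array is computed at run time. -/

/-- The contents of the memory: `word x i` and `num x i` are the cells with address `i` of the word
array and of the number array with name `x`. -/
structure State where
  word : ℕ → ℕ → ℕ
  num : ℕ → ℕ → ℝ

/-- Operations on words. -/
inductive WOp
  | add | sub | mul | div | mod

/-- Subtraction is truncated at `0`; division rounds down. -/
def WOp.apply : WOp → ℕ → ℕ → ℕ
  | .add, a, b => a + b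
  | .sub, a, b => a - b
  | .mul, a, b => a * b
  | .div, a, b => a / b
  | .mod, a, b => a % b

/-- Expressions whose values are words. -/
inductive WExp
  /-- a constant -/
  | lit (k : ℕ)
  /-- the cell of the word array `x` whose address is the value of `i` -/
  | read (x : ℕ) (i : WExp)
  | bin (o : WOp) (a b : WExp)

namespace WExp

/-- The value of an expression. -/
def eval (s : State) : WExp → ℕ
  | lit k => k
  | read x i => s.word x (i.eval s)
  | bin o a b => o.apply (a.eval s) (b.eval s)

/-- The number of elementary steps of the evaluation of an expression. -/
def size : WExp → ℕ
  | lit _ => 1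
  | read _ i => i.size + 1
  | bin _ a b => a.size + b.size + 1

/-- Every operation on words in the evaluation of the expression has a result at most `W`. -/
def Fits (W : ℕ) (s : State) : WExp → Prop
  | lit _ => True
  | read _ i => i.Fits W s
  | bin o a b => a.Fits W s ∧ b.Fits W s ∧ o.apply (a.eval s) (b.eval s) ≤ W

end WExp

/-- Operations on numbers. -/
inductive NOp
  | add | sub | mul | div

/-- Exact real arithmetic (division by `0` yields `0`). -/
noncomputable def NOp.apply : NOp → ℝ → ℝ → ℝ
  | .add, x, y => x + y
  | .sub, x, y => x - y
  | .mul, x, y => x * y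
  | .div, x, y => x / y

/-- A reference to a cell of the number memory: an array name and an address. -/
structure NRef where
  arr : ℕ
  addr : WExp

/-- The number stored in the cell. -/
def NRef.get (s : State) (v : NRef) : ℝ := s.num v.arr (v.addr.eval s)

/-- Tests. -/
inductive Test
  | wlt (a b : WExp)
  | weq (a b : WExp)
  | nlt (u v : NRef)
  | not (b : Test)
  | and (b c : Test)

namespace Test

/-- The test succeeds. -/
def Holds (s : State) : Test → Prop
  | wlt a b => a.eval s < b.eval s
  | weq a b => a.eval s = b.eval s
  | nlt u v => u.get s < v.get s
  | not b => ¬ b.Holds s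
  | and b c => b.Holds s ∧ c.Holds s

/-- The number of elementary steps of a test. -/
def size : Test → ℕ
  | wlt a b => a.size + b.size + 1
  | weq a b => a.size + b.size + 1
  | nlt u v => u.addr.size + v.addr.size + 3
  | not b => b.size + 1
  | and b c => b.size + c.size + 1

/-- Every operation on words in the test has a result at most `W`. -/
def Fits (W : ℕ) (s : State) : Test → Prop
  | wlt a b => a.Fits W s ∧ b.Fits W s
  | weq a b => a.Fits W s ∧ b.Fits W s
  | nlt u v => u.addr.Fits W s ∧ v.addr.Fits W s
  | not b => b.Fits W s
  | and b c => b.Fits W s ∧ c.Fits W s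

end Test

/-- Programs. -/
inductive Cmd
  | skip
  /-- write the value of `e` into the cell of the word array `x` with address `i` -/
  | setW (x : ℕ) (i e : WExp)
  /-- write a rational constant into a number cell -/
  | const (v : NRef) (k : ℚ)
  /-- write the number in the cell `u` into the cell `v` -/
  | copy (v u : NRef)
  /-- write the result of the operation on the numbers in `u₁`, `u₂` into the cell `v` -/
  | op (o : NOp) (v u₁ u₂ : NRef)
  | seq (c d : Cmd)
  | ite (b : Test) (c d : Cmd)
  | loop (b : Test) (c : Cmd)

namespace State

/-- Write the word `k` into the cell `i` of the word array `x`. -/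
def putW (s : State) (x i k : ℕ) : State :=
  ⟨Function.update s.word x (Function.update (s.word x) i k), s.num⟩

/-- Write the number `z` into the cell `v`. -/
noncomputable def putN (s : State) (v : NRef) (z : ℝ) : State :=
  ⟨s.word, Function.update s.num v.arr (Function.update (s.num v.arr) (v.addr.eval s) z)⟩

end State

/-- `Exec W A c s s' t`: the program `c`, started with memory contents `s`, terminates with memory
contents `s'` after exactly `t` elementary steps; on the way, every operation on words has a result
at most `W`, and every number that is written belongs to `A`.  Each operation on words or numbers,
each memory access and each test counts as a step. -/
inductive Exec (W : ℕ) (A : Set ℝ) : Cmd → State → State → ℕ → Prop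
  | skip (s : State) : Exec W A .skip s s 1
  | setW (s : State) (x : ℕ) (i e : WExp) (hi : i.Fits W s) (he : e.Fits W s) :
      Exec W A (.setW x i e) s (s.putW x (i.eval s) (e.eval s)) (i.size + e.size + 1)
  | const (s : State) (v : NRef) (k : ℚ) (hv : v.addr.Fits W s) (hk : (k : ℝ) ∈ A) :
      Exec W A (.const v k) s (s.putN v k) (v.addr.size + 1)
  | copy (s : State) (v u : NRef) (hv : v.addr.Fits W s) (hu : u.addr.Fits W s)
      (hA : u.get s ∈ A) :
      Exec W A (.copy v u) s (s.putN v (u.get s)) (v.addr.size + u.addr.size + 2)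
  | op (s : State) (o : NOp) (v u₁ u₂ : NRef) (hv : v.addr.Fits W s) (hu₁ : u₁.addr.Fits W s)
      (hu₂ : u₂.addr.Fits W s) (hA : o.apply (u₁.get s) (u₂.get s) ∈ A) :
      Exec W A (.op o v u₁ u₂) s (s.putN v (o.apply (u₁.get s) (u₂.get s)))
        (v.addr.size + u₁.addr.size + u₂.addr.size + 4)
  | seq {s s' s'' : State} {c d : Cmd} {t t' : ℕ} (hc : Exec W A c s s' t)
      (hd : Exec W A d s' s'' t') : Exec W A (.seq c d) s s'' (t + t')
  | ite_true {s s' : State} {b : Test} {c : Cmd} (d : Cmd) {t : ℕ} (hf : b.Fits W s)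
      (hb : b.Holds s) (hc : Exec W A c s s' t) : Exec W A (.ite b c d) s s' (b.size + t)
  | ite_false {s s' : State} {b : Test} (c : Cmd) {d : Cmd} {t : ℕ} (hf : b.Fits W s)
      (hb : ¬ b.Holds s) (hd : Exec W A d s s' t) : Exec W A (.ite b c d) s s' (b.size + t)
  | loop_true {s s' s'' : State} {b : Test} {c : Cmd} {t t' : ℕ} (hf : b.Fits W s)
      (hb : b.Holds s) (hc : Exec W A c s s' t) (hl : Exec W A (.loop b c) s' s'' t') :
      Exec W A (.loop b c) s s'' (b.size + t + t')
  | loop_false {s : State} {b : Test} (c : Cmd) (hf : b.Fits W s) (hb : ¬ b.Holds s) :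
      Exec W A (.loop b c) s s b.size

/-- The real number `x` is rational, and the numerator and the denominator of its reduced fraction
have at most `B` binary digits each. -/
def HasBits (B : ℕ) (x : ℝ) : Prop :=
  ∃ q : ℚ, (q : ℝ) = x ∧ q.num.natAbs.size ≤ B ∧ q.den.size ≤ B

namespace Setting

variable {ℓ n m : ℕ} (I : Setting ℓ n m)

/-- The initial memory contents: the word array `0` starts with `ℓ`, `n`, `m`; the number arrays
`0`, `1`, `2`, `3` hold the tables of `F`, `c`, `μ` and `r` in lexicographic order, so that `F θ a ω` has the address
`θ * (n * m) + (a * m + ω)` and `c θ a` has the address `θ * n + a`; all other cells hold `0`. -/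
noncomputable def input : State where
  word x i := if x = 0 then (if i = 0 then ℓ else if i = 1 then n else if i = 2 then m else 0)
    else 0
  num x i :=
    if x = 0 then
      if h : i < ℓ * (n * m) then
        let k := finProdFinEquiv.symm ⟨i, h⟩
        let l := finProdFinEquiv.symm k.2
        I.F k.1 l.1 l.2
      else 0
    else if x = 1 then
      if h : i < ℓ * n then
        let k := finProdFinEquiv.symm ⟨i, h⟩
        I.c k.1 k.2
      else 0
    else if x = 2 then (if h : i < ℓ then I.μ ⟨i, h⟩ else 0)
    else if x = 3 then (if h : i < m then I.r ⟨i, h⟩ else 0)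
    else 0

/-- All the numbers of the instance are rational, with numerators and denominators of at most `B`
binary digits. -/
def DataHasBits (B : ℕ) : Prop :=
  (∀ θ a ω, HasBits B (I.F θ a ω)) ∧ (∀ θ a, HasBits B (I.c θ a)) ∧
    (∀ θ, HasBits B (I.μ θ)) ∧ ∀ ω, HasBits B (I.r ω)

end Setting

/-- The contract that a program leaves in the first `m` cells of the number array `4`. -/
def output (m : ℕ) (s : State) : Fin m → ℝ := fun ω => s.num 4 ω

end BayesianPA

/-! Vertices suffice. For a fixed profile the principal's overall utility is a constant minus an
expected payment, which is linear in the contract. The polyhedron of the profile lies in the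
nonnegative orthant, so it contains no line, and the expected payment is nonnegative in every
recession direction. Hence every point of the polyhedron is improved by a vertex
(`exists_isBasic_le`, `exists_isBasicFor`). At that vertex the types may prefer other tied actions,
which can only help the principal (`overallUtility_le_of_implements`). A vertex is the only solution
of `m` tight equations chosen among `m` equations "a payment is zero" and `ℓ * n ^ 2` equations "two
actions give a type the same utility". This gives the binomial bound, and a best candidate is
optimal.

The algorithm enumerates all numbers with `m` digits in base `ℓ * n ^ 2 + 1`. The digit `0` in place
`i` stands for "payment `i` is zero", any other digit for an indifference equation. The system is
solved by Gauss-Jordan elimination without a search for pivots, negative payments are replaced by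
zero, the resulting contract is evaluated, and the best one is kept. A system on which the
elimination breaks down yields meaningless numbers, but still a contract whose true value is
computed, so it does no harm. No vertex is missed: by `exists_pivots` its tight equations can be
arranged so that no pivot vanishes, and every arrangement is enumerated (`exists_contract_eq`).

For `n ≥ 2`, both `m` and the number of systems are polynomial in `n ^ m` and `ℓ ^ m`. The number of
binary digits at most roughly quadruples in each elimination step, and the factor `4 ^ m` is at most
`(n ^ m) ^ 2`, so no determinant bounds are needed. For `n = 1` the parameters need not control `m`,
but there the zero contract is optimal and is already in memory.

The program is verified by Hoare-style rules (`Runs`, `Runs.count`), with time and word bounds read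
off the program text as polynomials in a bound on the stored words. The verification is done for an
abstract `Grading` of numbers. Its instances `Grading.univ` and `Grading.hasBits` give the real and
the rational statement, and determinism (`Exec.unique`) identifies the two runs. -/

namespace BayesianPA

/-! ### Polynomially bounded functions -/

/-- The function `f` is bounded by a polynomial. -/
def PolyBounded (f : ℕ → ℕ) : Prop := ∃ C d, ∀ V, f V ≤ C * (V + 1) ^ d

namespace PolyBounded

theorem const (k : ℕ) : PolyBounded fun _ => k := ⟨k, 0, by simp⟩

theorem id : PolyBounded fun V => V := ⟨1, 1, fun V => by simp⟩

theorem add {f g : ℕ → ℕ} (hf : PolyBounded f) (hg : PolyBounded g) :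
    PolyBounded fun V => f V + g V := by
  obtain ⟨C, d, h⟩ := hf
  obtain ⟨C', d', h'⟩ := hg
  refine ⟨C + C', d + d', fun V => ?_⟩
  rw [add_mul]
  refine add_le_add ((h V).trans ?_) ((h' V).trans ?_)
  · exact Nat.mul_le_mul_left _ (Nat.pow_le_pow_right V.succ_pos (Nat.le_add_right d d'))
  · exact Nat.mul_le_mul_left _ (Nat.pow_le_pow_right V.succ_pos (Nat.le_add_left d' d))

theorem mul {f g : ℕ → ℕ} (hf : PolyBounded f) (hg : PolyBounded g) :
    PolyBounded fun V => f V * g V := by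
  obtain ⟨C, d, h⟩ := hf
  obtain ⟨C', d', h'⟩ := hg
  refine ⟨C * C', d + d', fun V => (Nat.mul_le_mul (h V) (h' V)).trans (le_of_eq ?_)⟩
  rw [pow_add]
  ring

end PolyBounded

/-! ### Static bounds on words and on running time -/

/-- All words in the memory are at most `V`. -/
def State.Bdd (V : ℕ) (s : State) : Prop := ∀ x i, s.word x i ≤ V

theorem WOp.apply_le (o : WOp) (a b : ℕ) : o.apply a b ≤ a + b + a * b := by
  cases o
  · exact Nat.le_add_right _ _
  · exact (Nat.sub_le a b).trans (by simp [add_assoc])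
  · exact Nat.le_add_left _ _
  · exact (Nat.div_le_self a b).trans (by simp [add_assoc])
  · exact (Nat.mod_le a b).trans (by simp [add_assoc])

namespace WExp

/-- A bound on the words that occur in the evaluation, if the words in the memory are at
most `V`. -/
def bound (V : ℕ) : WExp → ℕ
  | lit k => k
  | read _ i => i.bound V + V
  | bin _ a b => a.bound V + b.bound V + (a.bound V + b.bound V + a.bound V * b.bound V)

theorem eval_le_bound {V : ℕ} {s : State} (hs : s.Bdd V) : ∀ e : WExp, e.eval s ≤ e.bound V
  | lit _ => le_rfl
  | read _ _ => (hs _ _).trans (Nat.le_add_left _ _)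
  | bin o a b => by
    refine (o.apply_le _ _).trans (le_trans ?_ (Nat.le_add_left _ _))
    have ha := eval_le_bound hs a
    have hb := eval_le_bound hs b
    gcongr

theorem fits_of_bound_le {V W : ℕ} {s : State} (hs : s.Bdd V) :
    ∀ e : WExp, e.bound V ≤ W → e.Fits W s
  | lit _, _ => trivial
  | read _ i, h => fits_of_bound_le hs i ((Nat.le_add_right _ _).trans h)
  | bin o a b, h => by
    have ha := eval_le_bound hs a
    have hb := eval_le_bound hs b
    simp only [bound] at h
    refine ⟨fits_of_bound_le hs a (by omega), fits_of_bound_le hs b (by omega), ?_⟩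
    refine (o.apply_le _ _).trans (le_trans ?_ h)
    refine le_trans ?_ (Nat.le_add_left _ _)
    gcongr

theorem polyBounded_bound : ∀ e : WExp, PolyBounded fun V => e.bound V
  | lit k => .const k
  | read _ i => (polyBounded_bound i).add .id
  | bin _ a b =>
    have ha := polyBounded_bound a
    have hb := polyBounded_bound b
    (ha.add hb).add ((ha.add hb).add (ha.mul hb))

end WExp

namespace Test

/-- A bound on the words that occur in the test. -/
def bound (V : ℕ) : Test → ℕ
  | wlt a b => a.bound V + b.bound V
  | weq a b => a.bound V + b.bound V
  | nlt u v => u.addr.bound V + v.addr.bound V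
  | not b => b.bound V
  | and b c => b.bound V + c.bound V

theorem fits_of_bound_le {V W : ℕ} {s : State} (hs : s.Bdd V) :
    ∀ b : Test, b.bound V ≤ W → b.Fits W s
  | wlt a b, h => ⟨a.fits_of_bound_le hs ((Nat.le_add_right _ _).trans h),
      b.fits_of_bound_le hs ((Nat.le_add_left _ _).trans h)⟩
  | weq a b, h => ⟨a.fits_of_bound_le hs ((Nat.le_add_right _ _).trans h),
      b.fits_of_bound_le hs ((Nat.le_add_left _ _).trans h)⟩
  | nlt u v, h => ⟨u.addr.fits_of_bound_le hs ((Nat.le_add_right _ _).trans h),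
      v.addr.fits_of_bound_le hs ((Nat.le_add_left _ _).trans h)⟩
  | not b, h => fits_of_bound_le hs b h
  | and b c, h => ⟨fits_of_bound_le hs b ((Nat.le_add_right _ _).trans h),
      fits_of_bound_le hs c ((Nat.le_add_left _ _).trans h)⟩

theorem polyBounded_bound : ∀ b : Test, PolyBounded fun V => b.bound V
  | wlt a b => a.polyBounded_bound.add b.polyBounded_bound
  | weq a b => a.polyBounded_bound.add b.polyBounded_bound
  | nlt u v => u.addr.polyBounded_bound.add v.addr.polyBounded_bound
  | not b => polyBounded_bound b
  | and b c => (polyBounded_bound b).add (polyBounded_bound c)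

end Test

namespace Cmd

/-- A bound on the words that occur in the run of a program that keeps the words in the memory at
most `V`. -/
def bound (V : ℕ) : Cmd → ℕ
  | skip => 0
  | setW _ i e => i.bound V + e.bound V
  | const v _ => v.addr.bound V
  | copy v u => v.addr.bound V + u.addr.bound V
  | op _ v u₁ u₂ => v.addr.bound V + u₁.addr.bound V + u₂.addr.bound V
  | seq c d => c.bound V + d.bound V
  | ite b c d => b.bound V + c.bound V + d.bound V
  | loop b c => b.bound V + c.bound V

/-- A bound on the running time of a program each of whose loops makes at most `V` iterations. -/
def cost (V : ℕ) : Cmd → ℕ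
  | skip => 1
  | setW _ i e => i.size + e.size + 1
  | const v _ => v.addr.size + 1
  | copy v u => v.addr.size + u.addr.size + 2
  | op _ v u₁ u₂ => v.addr.size + u₁.addr.size + u₂.addr.size + 4
  | seq c d => c.cost V + d.cost V
  | ite b c d => b.size + (c.cost V + d.cost V)
  | loop b c => (V + 1) * (b.size + c.cost V)

theorem polyBounded_bound : ∀ c : Cmd, PolyBounded fun V => c.bound V
  | skip => .const 0
  | setW _ i e => i.polyBounded_bound.add e.polyBounded_bound
  | const v _ => v.addr.polyBounded_bound
  | copy v u => v.addr.polyBounded_bound.add u.addr.polyBounded_bound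
  | op _ v u₁ u₂ =>
    (v.addr.polyBounded_bound.add u₁.addr.polyBounded_bound).add u₂.addr.polyBounded_bound
  | seq c d => (polyBounded_bound c).add (polyBounded_bound d)
  | ite b c d => (b.polyBounded_bound.add (polyBounded_bound c)).add (polyBounded_bound d)
  | loop b c => b.polyBounded_bound.add (polyBounded_bound c)

/-- The degree grows with the nesting of loops, which is a constant of the program. -/
theorem polyBounded_cost : ∀ c : Cmd, PolyBounded fun V => c.cost V
  | skip => .const _
  | setW _ _ _ => .const _
  | const _ _ => .const _
  | copy _ _ => .const _
  | op _ _ _ _ => .const _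
  | seq c d => (polyBounded_cost c).add (polyBounded_cost d)
  | ite b c d => (PolyBounded.const b.size).add ((polyBounded_cost c).add (polyBounded_cost d))
  | loop b c =>
    (PolyBounded.id.add (.const 1)).mul ((PolyBounded.const b.size).add (polyBounded_cost c))

/-- The word arrays that a program writes to. -/
def wmods : Cmd → List ℕ
  | skip | const _ _ | copy _ _ | op _ _ _ _ => []
  | setW x _ _ => [x]
  | seq c d => c.wmods ++ d.wmods
  | ite _ c d => c.wmods ++ d.wmods
  | loop _ c => c.wmods

/-- The number arrays that a program writes to. -/
def nmods : Cmd → List ℕ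
  | skip | setW _ _ _ => []
  | const v _ | copy v _ | op _ v _ _ => [v.arr]
  | seq c d => c.nmods ++ d.nmods
  | ite _ c d => c.nmods ++ d.nmods
  | loop _ c => c.nmods

end Cmd

/-! ### Updates of the memory -/

namespace State

@[simp] theorem putW_word (s : State) (x i k y j : ℕ) :
    (s.putW x i k).word y j = if y = x ∧ j = i then k else s.word y j := by
  by_cases h : y = x
  · subst h
    by_cases h' : j = i <;> simp [putW, h']
  · simp [putW, h]

@[simp] theorem putW_num (s : State) (x i k : ℕ) : (s.putW x i k).num = s.num := rfl

@[simp] theorem putN_word (s : State) (v : NRef) (z : ℝ) : (s.putN v z).word = s.word := rfl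

@[simp] theorem putN_num (s : State) (v : NRef) (z : ℝ) (y j : ℕ) :
    (s.putN v z).num y j = if y = v.arr ∧ j = v.addr.eval s then z else s.num y j := by
  by_cases h : y = v.arr
  · subst h
    by_cases h' : j = v.addr.eval s <;> simp [putN, h']
  · simp [putN, h]

theorem Bdd.putW {V : ℕ} {s : State} (hs : s.Bdd V) (x i : ℕ) {k : ℕ} (hk : k ≤ V) :
    (s.putW x i k).Bdd V := by
  intro y j
  rw [putW_word]
  split_ifs
  exacts [hk, hs y j]

end State

/-- The memory contents `s` and `s'` differ in the word arrays `ws` and the number arrays `ns`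
only. -/
structure Frame (ws ns : List ℕ) (s s' : State) : Prop where
  word : ∀ y, y ∉ ws → s'.word y = s.word y
  num : ∀ y, y ∉ ns → s'.num y = s.num y

theorem Frame.refl (ws ns : List ℕ) (s : State) : Frame ws ns s s :=
  ⟨fun _ _ => rfl, fun _ _ => rfl⟩

theorem Frame.trans {ws ns : List ℕ} {s s' s'' : State} (h : Frame ws ns s s')
    (h' : Frame ws ns s' s'') : Frame ws ns s s'' :=
  ⟨fun y hy => (h'.word y hy).trans (h.word y hy), fun y hy => (h'.num y hy).trans (h.num y hy)⟩

theorem Frame.mono {ws ns ws' ns' : List ℕ} {s s' : State} (h : Frame ws ns s s')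
    (hw : ws ⊆ ws') (hn : ns ⊆ ns') : Frame ws' ns' s s' :=
  ⟨fun y hy => h.word y fun h => hy (hw h), fun y hy => h.num y fun h => hy (hn h)⟩

theorem Frame.putW (ns : List ℕ) (s : State) (x i k : ℕ) : Frame [x] ns s (s.putW x i k) :=
  ⟨fun y hy => by simp only [List.mem_singleton] at hy; simp [State.putW, hy], fun _ _ => rfl⟩

theorem Frame.putN (ws : List ℕ) (s : State) (v : NRef) (z : ℝ) :
    Frame ws [v.arr] s (s.putN v z) :=
  ⟨fun _ _ => rfl, fun y hy => by simp only [List.mem_singleton] at hy; simp [State.putN, hy]⟩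

/-- The arrays a program may write to are visible in its text. Facts about all other arrays thus
survive a subprogram, and the side conditions are settled by `decide`. -/
theorem Exec.frame {W : ℕ} {A : Set ℝ} {c : Cmd} {s s' : State} {t : ℕ}
    (h : Exec W A c s s' t) : Frame c.wmods c.nmods s s' := by
  induction h with
  | skip s => exact .refl _ _ s
  | setW s x i e => exact .putW _ _ _ _ _
  | const s v => exact .putN _ _ _ _
  | copy s v => exact .putN _ _ _ _
  | op s o v => exact .putN _ _ _ _
  | seq _ _ h h' =>
    exact (h.mono (by simp [Cmd.wmods]) (by simp [Cmd.nmods])).trans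
      (h'.mono (by simp [Cmd.wmods]) (by simp [Cmd.nmods]))
  | ite_true _ _ _ _ h => exact h.mono (by simp [Cmd.wmods]) (by simp [Cmd.nmods])
  | ite_false _ _ _ _ h => exact h.mono (by simp [Cmd.wmods]) (by simp [Cmd.nmods])
  | loop_true _ _ _ _ h h' => exact h.trans h'
  | loop_false => exact .refl _ _ _

/-- The machine is deterministic. -/
theorem Exec.unique {W W' : ℕ} {A A' : Set ℝ} {c : Cmd} {s s₁ s₂ : State} {t₁ t₂ : ℕ}
    (h₁ : Exec W A c s s₁ t₁) (h₂ : Exec W' A' c s s₂ t₂) : s₁ = s₂ ∧ t₁ = t₂ := by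
  induction h₁ generalizing s₂ t₂ with
  | skip => cases h₂; exact ⟨rfl, rfl⟩
  | setW => cases h₂; exact ⟨rfl, rfl⟩
  | const => cases h₂; exact ⟨rfl, rfl⟩
  | copy => cases h₂; exact ⟨rfl, rfl⟩
  | op => cases h₂; exact ⟨rfl, rfl⟩
  | seq _ _ ih ih' =>
    cases h₂ with
    | seq k k' =>
      obtain ⟨rfl, rfl⟩ := ih k
      obtain ⟨rfl, rfl⟩ := ih' k'
      exact ⟨rfl, rfl⟩
  | ite_true _ _ hb _ ih =>
    cases h₂ with
    | ite_true _ _ _ k => obtain ⟨rfl, rfl⟩ := ih k; exact ⟨rfl, rfl⟩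
    | ite_false _ _ hb' _ => exact absurd hb hb'
  | ite_false _ _ hb _ ih =>
    cases h₂ with
    | ite_true _ _ hb' _ => exact absurd hb' hb
    | ite_false _ _ _ k => obtain ⟨rfl, rfl⟩ := ih k; exact ⟨rfl, rfl⟩
  | loop_true _ hb _ _ ih ih' =>
    cases h₂ with
    | loop_true _ _ k k' =>
      obtain ⟨rfl, rfl⟩ := ih k
      obtain ⟨rfl, rfl⟩ := ih' k'
      exact ⟨rfl, rfl⟩
    | loop_false _ _ hb' => exact absurd hb hb'
  | loop_false _ _ hb =>
    cases h₂ with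
    | loop_true _ hb' _ _ => exact absurd hb' hb
    | loop_false => exact ⟨rfl, rfl⟩

@[simp] theorem WExp.eval_putN (s : State) (v : NRef) (z : ℝ) :
    ∀ e : WExp, e.eval (s.putN v z) = e.eval s
  | lit _ => rfl
  | read _ i => by rw [eval, eval_putN s v z i, State.putN_word, ← eval]
  | bin _ a b => by rw [eval, eval_putN s v z a, eval_putN s v z b, ← eval]

theorem State.putN_num_self (s : State) (x : ℕ) (a : WExp) (z : ℝ) :
    (s.putN ⟨x, a⟩ z).num x = Function.update (s.num x) (a.eval s) z := by
  simp [putN]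

theorem State.putN_num_of_ne (s : State) (v : NRef) (z : ℝ) {y : ℕ} (h : y ≠ v.arr) :
    (s.putN v z).num y = s.num y := by
  simp [putN, h]

/-! ### Total correctness -/

/-- The program `c`, started in `s` with words at most `V`, halts within its static time bound in a
state that satisfies `Q`, keeps the words in the memory at most `V` and writes only numbers
in `A`. -/
def Runs (V : ℕ) (A : Set ℝ) (c : Cmd) (s : State) (Q : State → Prop) : Prop :=
  ∀ W, c.bound V ≤ W → s.Bdd V →
    ∃ s' t, Exec W A c s s' t ∧ t ≤ c.cost V ∧ s'.Bdd V ∧ Q s'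

namespace Runs

variable {V : ℕ} {A : Set ℝ} {c d : Cmd} {s : State} {Q R : State → Prop}

theorem conseq (h : Runs V A c s R) (hQ : ∀ s', Frame c.wmods c.nmods s s' → R s' → Q s') :
    Runs V A c s Q := by
  intro W hW hs
  obtain ⟨s', t, he, ht, hb, hr⟩ := h W hW hs
  exact ⟨s', t, he, ht, hb, hQ s' he.frame hr⟩

theorem skip (h : Q s) : Runs V A .skip s Q := fun _ _ hs => ⟨s, 1, .skip s, le_rfl, hs, h⟩

theorem setW {x : ℕ} {i e : WExp} (he : e.eval s ≤ V) (h : Q (s.putW x (i.eval s) (e.eval s))) :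
    Runs V A (.setW x i e) s Q := fun _ hW hs =>
  ⟨_, _, .setW s x i e (i.fits_of_bound_le hs ((Nat.le_add_right _ _).trans hW))
    (e.fits_of_bound_le hs ((Nat.le_add_left _ _).trans hW)), le_rfl, hs.putW _ _ he, h⟩

theorem const {v : NRef} {k : ℚ} (hk : (k : ℝ) ∈ A) (h : Q (s.putN v k)) :
    Runs V A (.const v k) s Q := fun _ hW hs =>
  ⟨_, _, .const s v k (v.addr.fits_of_bound_le hs hW) hk, le_rfl, hs, h⟩

theorem copy {v u : NRef} (hu : u.get s ∈ A) (h : Q (s.putN v (u.get s))) :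
    Runs V A (.copy v u) s Q := fun _ hW hs =>
  ⟨_, _, .copy s v u (v.addr.fits_of_bound_le hs ((Nat.le_add_right _ _).trans hW))
    (u.addr.fits_of_bound_le hs ((Nat.le_add_left _ _).trans hW)) hu, le_rfl, hs, h⟩

theorem op {o : NOp} {v u₁ u₂ : NRef} (hA : o.apply (u₁.get s) (u₂.get s) ∈ A)
    (h : Q (s.putN v (o.apply (u₁.get s) (u₂.get s)))) : Runs V A (.op o v u₁ u₂) s Q :=
  fun W hW hs => by
    simp only [Cmd.bound] at hW
    exact ⟨_, _, .op s o v u₁ u₂ (v.addr.fits_of_bound_le hs (by omega))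
      (u₁.addr.fits_of_bound_le hs (by omega)) (u₂.addr.fits_of_bound_le hs (by omega)) hA,
      le_rfl, hs, h⟩

theorem seq (h : Runs V A c s fun s' => Runs V A d s' Q) : Runs V A (.seq c d) s Q := by
  intro W hW hs
  simp only [Cmd.bound] at hW
  obtain ⟨s', t, he, ht, hb, hr⟩ := h W (by omega) hs
  obtain ⟨s'', t', he', ht', hb', hq⟩ := hr W (by omega) hb
  exact ⟨s'', t + t', .seq he he', add_le_add ht ht', hb', hq⟩

theorem ite {b : Test} (h : b.Holds s → Runs V A c s Q) (h' : ¬ b.Holds s → Runs V A d s Q) :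
    Runs V A (.ite b c d) s Q := by
  intro W hW hs
  simp only [Cmd.bound] at hW
  have hf := b.fits_of_bound_le hs (show b.bound V ≤ W by omega)
  by_cases hb : b.Holds s
  · obtain ⟨s', t, he, ht, hbd, hq⟩ := h hb W (by omega) hs
    exact ⟨s', _, .ite_true d hf hb he, by simp only [Cmd.cost]; omega, hbd, hq⟩
  · obtain ⟨s', t, he, ht, hbd, hq⟩ := h' hb W (by omega) hs
    exact ⟨s', _, .ite_false c hf hb he, by simp only [Cmd.cost]; omega, hbd, hq⟩

end Runs

/-! ### Counting loops -/

namespace WExp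

/-- The first cell of a word array. -/
def var (x : ℕ) : WExp := .read x (.lit 0)

@[simp] theorem eval_lit (s : State) (k : ℕ) : (lit k).eval s = k := rfl

@[simp] theorem eval_read (s : State) (x : ℕ) (i : WExp) :
    (read x i).eval s = s.word x (i.eval s) := rfl

@[simp] theorem eval_var (s : State) (x : ℕ) : (var x).eval s = s.word x 0 := rfl

instance : Add WExp := ⟨bin .add⟩
instance : Sub WExp := ⟨bin .sub⟩
instance : Mul WExp := ⟨bin .mul⟩
instance : Div WExp := ⟨bin .div⟩
instance : Mod WExp := ⟨bin .mod⟩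

variable (s : State) (a b : WExp)

@[simp] theorem eval_add : (a + b).eval s = a.eval s + b.eval s := rfl
@[simp] theorem eval_sub : (a - b).eval s = a.eval s - b.eval s := rfl
@[simp] theorem eval_mul : (a * b).eval s = a.eval s * b.eval s := rfl
@[simp] theorem eval_div : (a / b).eval s = a.eval s / b.eval s := rfl
@[simp] theorem eval_mod : (a % b).eval s = a.eval s % b.eval s := rfl

end WExp

/-- Repeat `c` while the word variable `x` runs from `0` up to the value of `e`, exclusively. -/
def Cmd.count (x : ℕ) (e : WExp) (c : Cmd) : Cmd :=
  .seq (.setW x (.lit 0) (.lit 0))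
    (.loop (.wlt (.var x) e) (.seq c (.setW x (.lit 0) (.var x + .lit 1))))

/-- The loop rule for invariants. The body leaves the counter alone and the limit `e` keeps its
value `b`, so there are exactly `b ≤ V` iterations, within the static cost. The invariant is
required after the counter has been advanced, because it speaks of the state at the next test. -/
theorem Runs.count {V : ℕ} {A : Set ℝ} {c : Cmd} {s : State} {x b : ℕ} {e : WExp}
    (Inv : ℕ → State → Prop) (hbV : b ≤ V) (hx : x ∉ c.wmods)
    (hb : ∀ s', Frame (x :: c.wmods) c.nmods s s' → e.eval s' = b)
    (h₀ : Inv 0 (s.putW x 0 0))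
    (hstep : ∀ k < b, ∀ s', Frame (x :: c.wmods) c.nmods s s' → s'.word x 0 = k → Inv k s' →
      Runs V A c s' fun s'' => Inv (k + 1) (s''.putW x 0 (k + 1))) :
    Runs V A (.count x e c) s (Inv b) := by
  intro W hW hs
  simp only [Cmd.count, Cmd.bound] at hW
  set B : Test := .wlt (.var x) e with hB
  set D : Cmd := .seq c (.setW x (.lit 0) (.var x + .lit 1)) with hD
  -- Induction on the number `j` of iterations that remain. Each costs one test and one pass through
  -- the body; the extra `B.size` is the final, failing test.
  have main : ∀ j k, k + j = b → ∀ s', Frame (x :: c.wmods) c.nmods s s' → s'.word x 0 = k →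
      s'.Bdd V → Inv k s' → ∃ s'' t, Exec W A (.loop B D) s' s'' t ∧
        t ≤ j * (B.size + D.cost V) + B.size ∧ s''.Bdd V ∧ Inv b s'' := by
    intro j
    induction j with
    | zero =>
      intro k hk s' hf hxk hbd hi
      obtain rfl : k = b := by omega
      refine ⟨s', _, .loop_false _ (B.fits_of_bound_le hbd (by omega)) ?_, by simp, hbd, hi⟩
      simp [hB, Test.Holds, hxk, hb s' hf]
    | succ j ih =>
      intro k hk s' hf hxk hbd hi
      have hDr : Runs V A D s' fun s'' => Frame (x :: c.wmods) c.nmods s s'' ∧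
          s''.word x 0 = k + 1 ∧ Inv (k + 1) s'' := by
        refine Runs.seq ((hstep k (by omega) s' hf hxk hi).conseq fun s'' hf'' hi'' => ?_)
        have hxk' : s''.word x 0 = k := by rw [hf''.word x hx, hxk]
        refine Runs.setW (by simp [hxk']; omega) ?_
        simp only [WExp.eval_lit, WExp.eval_add, WExp.eval_var, hxk']
        refine ⟨(hf.trans (hf''.mono (by simp) (by simp))).trans
          ((Frame.putW _ _ _ _ _).mono (by simp) (List.Subset.refl _)), by simp, hi''⟩
      obtain ⟨s₁, t₁, he₁, ht₁, hb₁, hf₁, hx₁, hi₁⟩ := hDr W (by simp only [hD, Cmd.bound]; omega) hbd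
      obtain ⟨s₂, t₂, he₂, ht₂, hb₂, hi₂⟩ := ih (k + 1) (by omega) s₁ hf₁ hx₁ hb₁ hi₁
      refine ⟨s₂, _, .loop_true (B.fits_of_bound_le hbd (by omega)) ?_ he₁ he₂, ?_, hb₂, hi₂⟩
      · simp [hB, Test.Holds, hxk, hb s' hf]
        omega
      · rw [add_mul]
        omega
  obtain ⟨s', t, he, ht, hbd, hi⟩ := main b 0 (by omega) (s.putW x 0 0)
    ((Frame.putW _ _ _ _ _).mono (by simp) (List.Subset.refl _)) (by simp)
    (hs.putW _ _ (Nat.zero_le _)) h₀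
  refine ⟨s', _, .seq (.setW s x (.lit 0) (.lit 0) trivial trivial) he, ?_, hbd, hi⟩
  simp only [Cmd.count, Cmd.cost, WExp.size]
  refine Nat.add_le_add_left (ht.trans ?_) _
  rw [add_mul, one_mul]
  refine add_le_add (Nat.mul_le_mul_right _ hbV) ?_
  exact Nat.le_add_right _ _

/-! ### Polyhedra -/

section Polyhedron

variable {E : Type*} [AddCommGroup E] [Module ℝ E] {ι : Type*}

/-- The polyhedron given by the inequalities `β i ≤ L i p`. -/
def polyhedron (L : ι → E →ₗ[ℝ] ℝ) (β : ι → ℝ) : Set E := {p | ∀ i, β i ≤ L i p}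

/-- The constraints that are tight at `p` determine `p`. -/
def IsBasic (L : ι → E →ₗ[ℝ] ℝ) (β : ι → ℝ) (p : E) : Prop :=
  ∀ v, (∀ i, L i p = β i → L i v = 0) → v = 0

variable {L : ι → E →ₗ[ℝ] ℝ} {β : ι → ℝ}

/-- A constraint that is tight at a proper convex combination of two feasible points is tight at
both. The tight constraints therefore vanish on the differences of these points from `p`. -/
theorem IsBasic.mem_extremePoints {p : E} (hp : p ∈ polyhedron L β) (h : IsBasic L β p) :
    p ∈ (polyhedron L β).extremePoints ℝ := by
  refine _root_.mem_extremePoints.2 ⟨hp, fun x hx y hy hpxy => ?_⟩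
  obtain ⟨a, b, ha, hb, hab, rfl⟩ := hpxy
  have key : ∀ i, L i (a • x + b • y) = β i → L i x = β i ∧ L i y = β i := by
    intro i hi
    simp only [map_add, map_smul, smul_eq_mul] at hi
    have h1 := hx i
    have h2 := hy i
    obtain rfl : b = 1 - a := by linarith
    have h3 : 0 ≤ a * (L i x - β i) := mul_nonneg ha.le (by linarith)
    have h4 : 0 ≤ (1 - a) * (L i y - β i) := mul_nonneg hb.le (by linarith)
    have h5 : a * (L i x - β i) = 0 := by linarith
    have h6 : (1 - a) * (L i y - β i) = 0 := by linarith
    constructor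
    · have := (mul_eq_zero.1 h5).resolve_left ha.ne'; linarith
    · have := (mul_eq_zero.1 h6).resolve_left hb.ne'; linarith
  refine ⟨sub_eq_zero.1 (h _ fun i hi => ?_), sub_eq_zero.1 (h _ fun i hi => ?_)⟩
  · rw [map_sub, (key i hi).1, hi, sub_self]
  · rw [map_sub, (key i hi).2, hi, sub_self]

/-- If the tight constraints vanish on `v`, then `p + ε • v` and `p - ε • v` are feasible for small
`ε > 0`, since the finitely many slack constraints have room. As `p` is their midpoint, `v = 0`. -/
theorem isBasic_of_mem_extremePoints [Finite ι] {p : E}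
    (hp : p ∈ (polyhedron L β).extremePoints ℝ) : IsBasic L β p := by
  intro v hv
  have h1 : ∀ᶠ ε in nhds (0 : ℝ), ∀ i, β i ≤ L i p + ε * L i v ∧ β i ≤ L i p - ε * L i v := by
    refine Filter.eventually_all.2 fun i => ?_
    rcases (hp.1 i).eq_or_lt with h | h
    · refine .of_forall fun ε => ?_
      rw [hv i h.symm, h]
      simp
    · have c1 : Filter.Tendsto (fun ε => L i p + ε * L i v) (nhds 0) (nhds (L i p + 0 * L i v)) :=
        (by fun_prop : Continuous fun ε : ℝ => L i p + ε * L i v).tendsto 0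
      have c2 : Filter.Tendsto (fun ε => L i p - ε * L i v) (nhds 0) (nhds (L i p - 0 * L i v)) :=
        (by fun_prop : Continuous fun ε : ℝ => L i p - ε * L i v).tendsto 0
      filter_upwards [c1.eventually (lt_mem_nhds (by simpa using h)),
        c2.eventually (lt_mem_nhds (by simpa using h))] with ε a b
      exact ⟨a.le, b.le⟩
  obtain ⟨ε, hε, hε0⟩ := ((h1.filter_mono nhdsWithin_le_nhds).and
    (self_mem_nhdsWithin : ∀ᶠ ε in nhdsWithin (0 : ℝ) (Set.Ioi 0), ε ∈ Set.Ioi 0)).exists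
  have hε0 : 0 < ε := hε0
  have h2 := (mem_extremePoints.1 hp).2 (p + ε • v) (fun i => by simpa using (hε i).1)
    (p - ε • v) (fun i => by simpa using (hε i).2)
    ⟨1 / 2, 1 / 2, by norm_num, by norm_num, by norm_num, by module⟩
  have h3 : ε • v = 0 := by simpa using h2.1
  exact (smul_eq_zero.1 h3).resolve_left hε0.ne'

/-- From a point `p` of a polyhedron, one can move in a direction that violates some constraint,
keeping the tight constraints tight, until a further constraint becomes tight. -/
theorem exists_ratio [Finite ι] {f g : ι → ℝ} (hf : ∀ i, 0 ≤ f i) (hfg : ∀ i, f i = 0 → g i = 0)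
    (hg : ∃ i, g i < 0) : ∃ t : ℝ, 0 ≤ t ∧ (∀ i, 0 ≤ f i + t * g i) ∧
      ∃ i, f i ≠ 0 ∧ f i + t * g i = 0 := by
  cases nonempty_fintype ι
  classical
  obtain ⟨i₀, hi₀⟩ := hg
  -- The ratio test of the simplex method: the decreasing constraint that reaches zero first
  -- determines the step length.
  obtain ⟨j, hj, hmin⟩ := Finset.exists_min_image (Finset.univ.filter fun i => g i < 0)
    (fun i => f i / -g i) ⟨i₀, by simp [hi₀]⟩
  simp only [Finset.mem_filter, Finset.mem_univ, true_and] at hj hmin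
  refine ⟨f j / -g j, div_nonneg (hf j) (by linarith), fun i => ?_, j, fun h => ?_, ?_⟩
  · rcases lt_or_ge (g i) 0 with h | h
    · have := hmin i h
      rw [le_div_iff₀ (by linarith)] at this
      linarith
    · exact add_nonneg (hf i) (mul_nonneg (div_nonneg (hf j) (by linarith)) h)
  · exact hj.ne (hfg j h)
  · have := hj.ne
    field_simp
    ring

/-- A linear function that is nonnegative on the recession cone of a polyhedron without lines is
improved, from any point of the polyhedron, by a basic point. -/
theorem exists_isBasic_le [Finite ι] (hline : ∀ v, (∀ i, L i v = 0) → v = 0) (φ : E →ₗ[ℝ] ℝ)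
    (hφ : ∀ v, (∀ i, 0 ≤ L i v) → 0 ≤ φ v) {q : E} (hq : q ∈ polyhedron L β) :
    ∃ p ∈ polyhedron L β, IsBasic L β p ∧ φ p ≤ φ q := by
  -- Induction on the number of slack constraints: a move along a direction on which the tight
  -- constraints vanish, stopped at the first new tight constraint, lowers it.
  induction hN : {i | L i q ≠ β i}.ncard using Nat.strong_induction_on generalizing q with
  | _ N ih =>
    by_cases hbas : IsBasic L β q
    · exact ⟨q, hq, hbas, le_rfl⟩
    have step : ∀ v, (∀ i, L i q = β i → L i v = 0) → φ v ≤ 0 → (∃ i, L i v < 0) →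
        ∃ p ∈ polyhedron L β, IsBasic L β p ∧ φ p ≤ φ q := by
      intro v hv hφv hneg
      obtain ⟨t, ht, hfeas, j, hj, hj'⟩ := exists_ratio (f := fun i => L i q - β i)
        (g := fun i => L i v) (fun i => sub_nonneg.2 (hq i))
        (fun i hi => hv i (sub_eq_zero.1 hi)) hneg
      have hq' : q + t • v ∈ polyhedron L β := fun i => by
        have := hfeas i
        simp only [map_add, map_smul, smul_eq_mul]
        linarith
      have hlt : {i | L i (q + t • v) ≠ β i}.ncard < N := by
        rw [← hN]
        refine Set.ncard_lt_ncard (Set.ssubset_iff_of_subset ?_ |>.2 ⟨j, ?_, ?_⟩)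
        · intro i hi h
          apply hi
          simp [hv i h, h]
        · simpa [sub_eq_zero] using hj
        · simp only [map_add, map_smul, smul_eq_mul, Set.mem_ofPred_eq, ne_eq, not_not]
          linarith
      obtain ⟨p, hp, hb, hle⟩ := ih _ hlt hq' rfl
      refine ⟨p, hp, hb, hle.trans ?_⟩
      simp only [map_add, map_smul, smul_eq_mul]
      nlinarith
    simp only [IsBasic, not_forall] at hbas
    obtain ⟨v, hv, hv0⟩ := hbas
    -- If no constraint decreases along `v`, then `v` is a recession direction, so `φ v = 0` and the
    -- opposite direction is just as good. If no constraint decreases along `-v` either, `v` spans a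
    -- line.
    have main : ∀ v, (∀ i, L i q = β i → L i v = 0) → v ≠ 0 → φ v ≤ 0 →
        ∃ p ∈ polyhedron L β, IsBasic L β p ∧ φ p ≤ φ q := by
      intro v hv hv0 hφv
      by_cases h : ∃ i, L i v < 0
      · exact step v hv hφv h
      push Not at h
      have h0 : φ v = 0 := le_antisymm hφv (hφ v h)
      by_cases h' : ∃ i, L i (-v) < 0
      · exact step (-v) (fun i hi => by simp [hv i hi]) (by simp [h0]) h'
      push Not at h'
      refine absurd (hline v fun i => le_antisymm ?_ (h i)) hv0
      simpa using h' i
    rcases le_total (φ v) 0 with h | h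
    · exact main v hv hv0 h
    · exact main (-v) (fun i hi => by simp [hv i hi]) (by simpa using hv0) (by simpa using h)

/-- A basic point is determined by as many tight constraints as the dimension of the space. -/
theorem IsBasic.exists_finset [Fintype ι] [FiniteDimensional ℝ E] {p : E} (h : IsBasic L β p) :
    ∃ S : Finset ι, S.card = Module.finrank ℝ E ∧ (∀ i ∈ S, L i p = β i) ∧
      ∀ v, (∀ i ∈ S, L i v = 0) → v = 0 := by
  -- A maximal independent family of tight functionals spans the same space as all of them. Its
  -- common kernel is zero, so its size is the dimension.
  obtain ⟨κ, a, ha, hspan, hli⟩ :=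
    exists_linearIndependent' ℝ fun i : {i // L i p = β i} => (L i : Module.Dual ℝ E)
  have hco : (Submodule.span ℝ (Set.range fun i : {i // L i p = β i} =>
      (L i : Module.Dual ℝ E))).dualCoannihilator = ⊥ := by
    refine (Submodule.eq_bot_iff _).2 fun v hv => h v fun i hi => ?_
    exact (Submodule.mem_dualCoannihilator v).1 hv _ (Submodule.subset_span ⟨⟨i, hi⟩, rfl⟩)
  have hfin : Finite κ := Finite.of_injective a ha
  cases nonempty_fintype κ
  refine ⟨Finset.univ.map ⟨fun k => (a k : ι), Subtype.val_injective.comp ha⟩, ?_, ?_, ?_⟩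
  · have h1 := Subspace.finrank_add_finrank_dualCoannihilator_eq
      (Submodule.span ℝ (Set.range fun i : {i // L i p = β i} => (L i : Module.Dual ℝ E)))
    rw [hco, finrank_bot, add_zero, ← hspan, finrank_span_eq_card hli] at h1
    simpa using h1
  · intro i hi
    simp only [Finset.mem_map, Finset.mem_univ, true_and] at hi
    obtain ⟨k, rfl⟩ := hi
    exact (a k).2
  · intro v hv
    rw [← Submodule.mem_bot ℝ, ← hco, ← hspan, Submodule.mem_dualCoannihilator]
    intro φ hφ
    induction hφ using Submodule.span_induction with
    | mem x hx =>
      obtain ⟨k, rfl⟩ := hx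
      exact hv _ (Finset.mem_map_of_mem _ (Finset.mem_univ k))
    | zero => rfl
    | add x y _ _ hx hy => rw [LinearMap.add_apply, hx, hy, add_zero]
    | smul c x _ hx => rw [LinearMap.smul_apply, hx, smul_zero]

end Polyhedron

/-! ### Optimal contracts among the vertices -/

namespace Setting

variable {ℓ n m : ℕ} (I : Setting ℓ n m)

/-- The expected payment as a linear function of the contract. -/
noncomputable def paymentL (θ : Fin ℓ) (a : Fin n) : (Fin m → ℝ) →ₗ[ℝ] ℝ :=
  ∑ ω, I.F θ a ω • LinearMap.proj ω

@[simp] theorem paymentL_apply (p : Fin m → ℝ) (θ : Fin ℓ) (a : Fin n) :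
    I.paymentL θ a p = I.payment p θ a := by
  simp [paymentL, payment]

/-- The left-hand sides of the constraints: nonnegativity of payments, and incentive
compatibility of one action compared with another one. -/
noncomputable def conL : Fin m ⊕ (Fin ℓ × Fin n × Fin n) → (Fin m → ℝ) →ₗ[ℝ] ℝ
  | .inl ω => LinearMap.proj ω
  | .inr x => I.paymentL x.1 x.2.1 - I.paymentL x.1 x.2.2

/-- The right-hand sides of the constraints. -/
def conB : Fin m ⊕ (Fin ℓ × Fin n × Fin n) → ℝ
  | .inl _ => 0
  | .inr x => I.c x.1 x.2.1 - I.c x.1 x.2.2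

/-- The constraints that define the polyhedron of an action profile. -/
def profileCon (b : Fin ℓ → Fin n) :
    Fin m ⊕ (Fin ℓ × Fin n) → Fin m ⊕ (Fin ℓ × Fin n × Fin n) :=
  Sum.map id fun x => (x.1, b x.1, x.2)

/-- This keeps the number of constraints equal to `m` when the tight constraints of one profile are
viewed in the list common to all profiles. -/
theorem profileCon_injective (b : Fin ℓ → Fin n) :
    Function.Injective (profileCon (m := m) b) :=
  Function.injective_id.sumMap fun x y h => by
    simp only [Prod.mk.injEq] at h
    exact Prod.ext h.1 h.2.2

theorem profilePolytope_eq (b : Fin ℓ → Fin n) :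
    I.profilePolytope b =
      polyhedron (fun i => I.conL (profileCon b i)) fun i => I.conB (profileCon b i) := by
  ext p
  simp only [profilePolytope, polyhedron, IC, agentUtility, Set.mem_ofPred_eq, Sum.forall,
    profileCon, Sum.map_inl, Sum.map_inr, conL, conB, id, LinearMap.proj_apply,
    LinearMap.sub_apply, paymentL_apply, Prod.forall]
  refine and_congr Iff.rfl (forall_congr' fun θ => forall_congr' fun a => ?_)
  constructor <;> intro h <;> linarith

/-- The contract `p` is a basic point of the polyhedron of the profile `b`. -/
def IsBasicFor (b : Fin ℓ → Fin n) (p : Fin m → ℝ) : Prop :=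
  IsBasic (fun i => I.conL (profileCon b i)) (fun i => I.conB (profileCon b i)) p

theorem mem_candidates {p : Fin m → ℝ} :
    p ∈ I.candidates ↔ ∃ b, p ∈ I.profilePolytope b ∧ I.IsBasicFor b p := by
  simp only [candidates, Set.mem_iUnion, profilePolytope_eq]
  exact exists_congr fun b => ⟨fun h => ⟨h.1, isBasic_of_mem_extremePoints h⟩,
    fun h => h.2.mem_extremePoints h.1⟩

theorem μ_nonneg (θ : Fin ℓ) : 0 ≤ I.μ θ := I.μ_mem.1 θ

theorem payment_nonneg {p : Fin m → ℝ} (hp : ∀ ω, 0 ≤ p ω) (θ : Fin ℓ) (a : Fin n) :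
    0 ≤ I.payment p θ a :=
  Finset.sum_nonneg fun ω _ => mul_nonneg ((I.F_mem θ a).1 ω) (hp ω)

theorem reward_nonneg (θ : Fin ℓ) (a : Fin n) : 0 ≤ I.reward θ a :=
  Finset.sum_nonneg fun ω _ => mul_nonneg ((I.F_mem θ a).1 ω) (I.r_mem ω).1

/-- Every contract in the polyhedron of a profile is improved, for this profile, by a vertex. -/
theorem exists_isBasicFor {b : Fin ℓ → Fin n} {q : Fin m → ℝ} (hq : q ∈ I.profilePolytope b) :
    ∃ p ∈ I.profilePolytope b, I.IsBasicFor b p ∧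
      I.overallUtility q b ≤ I.overallUtility p b := by
  rw [profilePolytope_eq] at hq ⊢
  -- The coordinates are among the constraints, so recession directions are nonnegative vectors, on
  -- which expected payments are nonnegative.
  have hφ : ∀ v : Fin m → ℝ, (∀ i, 0 ≤ I.conL (profileCon b i) v) →
      0 ≤ (∑ θ, I.μ θ • I.paymentL θ (b θ)) v := by
    intro v hv
    simp only [LinearMap.sum_apply, LinearMap.smul_apply, paymentL_apply, smul_eq_mul]
    exact Finset.sum_nonneg fun θ _ =>
      mul_nonneg (I.μ_nonneg θ) (I.payment_nonneg (fun ω => hv (.inl ω)) θ _)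
  obtain ⟨p, hp, hb, hle⟩ := exists_isBasic_le
    (L := fun i => I.conL (profileCon b i)) (β := fun i => I.conB (profileCon b i))
    (fun v hv => funext fun ω => hv (.inl ω)) _ hφ hq
  refine ⟨p, hp, hb, ?_⟩
  simp only [LinearMap.sum_apply, LinearMap.smul_apply, paymentL_apply, smul_eq_mul] at hle
  simp only [overallUtility, principalUtility, mul_sub, Finset.sum_sub_distrib]
  linarith

/-- The principal obtains `u` from the contract `p`. -/
def HasValue (p : Fin m → ℝ) (u : ℝ) : Prop :=
  ∃ a : Fin ℓ → Fin n, (∀ θ, I.Implements p θ (a θ)) ∧ I.overallUtility p a = u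

/-- An implemented profile is best among the incentive compatible ones. -/
theorem overallUtility_le_of_implements {p : Fin m → ℝ} {a b : Fin ℓ → Fin n}
    (ha : ∀ θ, I.Implements p θ (a θ)) (hb : ∀ θ, I.IC p θ (b θ)) :
    I.overallUtility p b ≤ I.overallUtility p a :=
  Finset.sum_le_sum fun θ _ => mul_le_mul_of_nonneg_left ((ha θ).2 _ (hb θ)) (I.μ_nonneg θ)

theorem exists_implements (p : Fin m → ℝ) (θ : Fin ℓ) : ∃ a, I.Implements p θ a := by
  classical
  obtain ⟨a₀, -⟩ := I.exists_free
  obtain ⟨a₁, -, h₁⟩ := Finset.exists_max_image Finset.univ (I.agentUtility p θ) ⟨a₀, by simp⟩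
  obtain ⟨a, ha, h⟩ := Finset.exists_max_image (Finset.univ.filter (I.IC p θ))
    (I.principalUtility p θ) ⟨a₁, by simpa [IC] using h₁⟩
  simp only [Finset.mem_filter, Finset.mem_univ, true_and] at ha h
  exact ⟨a, ha, h⟩

theorem exists_hasValue (p : Fin m → ℝ) : ∃ u, I.HasValue p u := by
  choose a ha using I.exists_implements p
  exact ⟨_, a, ha, rfl⟩

/-- A contract is optimal if its value is at least that of every candidate. -/
theorem isOptimal_of_forall_candidates {p : Fin m → ℝ} (hp : ∀ ω, 0 ≤ p ω) {u : ℝ}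
    (hu : I.HasValue p u) (h : ∀ q ∈ I.candidates, ∃ w ≤ u, I.HasValue q w) : I.IsOptimal p := by
  obtain ⟨a, ha, rfl⟩ := hu
  refine ⟨hp, a, ha, fun q hq b hb => ?_⟩
  -- The profile `b` stays incentive compatible at the vertex `q'`, but ties may be broken
  -- differently there. The profile that `q'` implements is at least as good as `b`.
  obtain ⟨q', hq', hbas, hle⟩ := I.exists_isBasicFor (q := q) (b := b) ⟨hq, fun θ => (hb θ).1⟩
  obtain ⟨w, hw, a', ha', rfl⟩ := h q' (I.mem_candidates.2 ⟨b, hq', hbas⟩)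
  exact hle.trans ((I.overallUtility_le_of_implements ha' hq'.2).trans hw)

/-- Every candidate is the only solution of the tight equations for some `m` constraints. -/
theorem exists_finset_of_mem_candidates {p : Fin m → ℝ} (hp : p ∈ I.candidates) :
    ∃ S : Finset (Fin m ⊕ (Fin ℓ × Fin n × Fin n)), S.card = m ∧
      (∀ i ∈ S, I.conL i p = I.conB i) ∧ ∀ v, (∀ i ∈ S, I.conL i v = 0) → v = 0 := by
  obtain ⟨b, -, hb⟩ := I.mem_candidates.1 hp
  obtain ⟨S, hS, htight, hnull⟩ := IsBasic.exists_finset hb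
  refine ⟨S.map ⟨_, profileCon_injective b⟩, ?_, ?_, fun v hv => hnull v fun i hi => ?_⟩
  · simpa using hS
  · intro i hi
    obtain ⟨j, hj, rfl⟩ := Finset.mem_map.1 hi
    exact htight j hj
  · exact hv _ (Finset.mem_map_of_mem _ hi)

/-- Two candidates with the same determining set of `m` tight equations differ by a vector on which
all these equations vanish, so they coincide. It remains to count the `m`-element subsets of the
common list of constraints. -/
theorem candidates_finite_and_ncard_le :
    I.candidates.Finite ∧ I.candidates.ncard ≤ (ℓ * n ^ 2 + m).choose m := by
  classical
  have hex : ∀ p, ∃ S : Finset (Fin m ⊕ (Fin ℓ × Fin n × Fin n)), p ∈ I.candidates →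
      S.card = m ∧ (∀ i ∈ S, I.conL i p = I.conB i) ∧
        ∀ v, (∀ i ∈ S, I.conL i v = 0) → v = 0 := by
    intro p
    by_cases hp : p ∈ I.candidates
    · exact (I.exists_finset_of_mem_candidates hp).imp fun S hS _ => hS
    · exact ⟨∅, fun h => absurd h hp⟩
  choose S hS using hex
  have hmaps : ∀ p ∈ I.candidates,
      S p ∈ (Finset.powersetCard m Finset.univ : Finset (Finset _)) := fun p hp =>
    Finset.mem_powersetCard.2 ⟨Finset.subset_univ _, (hS p hp).1⟩
  have hinj : Set.InjOn S I.candidates := by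
    intro p hp q hq h
    refine sub_eq_zero.1 ((hS p hp).2.2 _ fun i hi => ?_)
    rw [map_sub, (hS p hp).2.1 i hi, (hS q hq).2.1 i (h ▸ hi), sub_self]
  refine ⟨Set.Finite.of_injOn hmaps hinj (Finset.finite_toSet _), ?_⟩
  refine (Set.ncard_le_ncard_of_injOn S hmaps hinj (Finset.finite_toSet _)).trans ?_
  rw [Set.ncard_coe_finset, Finset.card_powersetCard]
  refine (congrArg (fun k => Nat.choose k m) ?_).le
  simp only [Finset.card_univ, Fintype.card_sum, Fintype.card_prod, Fintype.card_fin]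
  ring

theorem exists_mem_candidates_isOptimal : ∃ p ∈ I.candidates, I.IsOptimal p := by
  choose u hu using I.exists_hasValue
  obtain ⟨a, ha, -⟩ := hu 0
  -- There is a candidate at all: the polyhedron of a profile implemented by the zero contract is
  -- nonempty and hence has a vertex.
  obtain ⟨p₀, hp₀, hb₀, -⟩ := I.exists_isBasicFor (q := 0) (b := a)
    ⟨fun _ => le_rfl, fun θ => (ha θ).1⟩
  obtain ⟨p, hp, hmax⟩ := Set.exists_max_image I.candidates u I.candidates_finite_and_ncard_le.1
    ⟨p₀, I.mem_candidates.2 ⟨a, hp₀, hb₀⟩⟩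
  obtain ⟨b, hb, -⟩ := I.mem_candidates.1 hp
  exact ⟨p, hp, I.isOptimal_of_forall_candidates hb.1 (hu p) fun q hq =>
    ⟨u q, hmax q hq, hu q⟩⟩

end Setting

/-! ### Elimination without pivoting -/

/-- The step of the Gauss-Jordan elimination that clears the column `k` with the row `k`. -/
noncomputable def gaussStep (k : ℕ) (X : ℕ → ℕ → ℝ) : ℕ → ℕ → ℝ := fun i j =>
  if i = k then X k j / X k k else X i j - X i k * (X k j / X k k)

/-- The table after the first `k` steps of the elimination. -/
noncomputable def gauss (X : ℕ → ℕ → ℝ) : ℕ → ℕ → ℕ → ℝ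
  | 0 => X
  | k + 1 => gaussStep k (gauss X k)

/-- The value of a linear form with the coefficients `a`. -/
def dot (N : ℕ) (a v : ℕ → ℝ) : ℝ := ∑ j ∈ Finset.range N, a j * v j

/-- The coefficients of a coordinate function. -/
def unitRow (i : ℕ) : ℕ → ℝ := fun j => if i = j then 1 else 0

theorem dot_unitRow {N i : ℕ} (hi : i < N) (v : ℕ → ℝ) : dot N (unitRow i) v = v i := by
  simp [dot, unitRow, hi]

theorem dot_gaussStep (N k : ℕ) (X : ℕ → ℕ → ℝ) (v : ℕ → ℝ) (i : ℕ) :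
    dot N (gaussStep k X i) v =
      if i = k then dot N (X k) v / X k k else dot N (X i) v - X i k * (dot N (X k) v / X k k) := by
  unfold gaussStep dot
  split_ifs
  · rw [Finset.sum_div]
    exact Finset.sum_congr rfl fun j _ => by ring
  · rw [Finset.sum_div, Finset.mul_sum, ← Finset.sum_sub_distrib]
    exact Finset.sum_congr rfl fun j _ => by ring

/-- The elimination preserves the solutions of the system of the first rows. -/
theorem dot_gaussStep_eq_zero_iff {N k r : ℕ} {X : ℕ → ℕ → ℝ} (hk : k < r) (h : X k k ≠ 0)
    (v : ℕ → ℝ) :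
    (∀ i < r, dot N (gaussStep k X i) v = 0) ↔ ∀ i < r, dot N (X i) v = 0 := by
  constructor
  · intro H
    have h1 : dot N (X k) v = 0 := by
      have := H k hk
      rw [dot_gaussStep, if_pos rfl] at this
      exact (div_eq_zero_iff.1 this).resolve_right h
    intro i hi
    have := H i hi
    rw [dot_gaussStep, h1] at this
    split_ifs at this with hik
    · rw [hik, h1]
    · simpa using this
  · intro H i hi
    rw [dot_gaussStep, H k hk, H i hi]
    simp

theorem dot_gauss_eq_zero_iff {N r : ℕ} {X : ℕ → ℕ → ℝ} (v : ℕ → ℝ) {q : ℕ} (hq : q ≤ r)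
    (h : ∀ k < q, gauss X k k k ≠ 0) :
    (∀ i < r, dot N (gauss X q i) v = 0) ↔ ∀ i < r, dot N (X i) v = 0 := by
  induction q with
  | zero => rfl
  | succ q ih =>
    exact (dot_gaussStep_eq_zero_iff (by omega) (h q (by omega)) v).trans
      (ih (by omega) fun k hk => h k (by omega))

/-- A later step leaves a cleared column alone, because its pivot row has a zero there. -/
theorem gauss_column {X : ℕ → ℕ → ℝ} {q : ℕ} (h : ∀ k < q, gauss X k k k ≠ 0) (i : ℕ) {j : ℕ}
    (hj : j < q) : gauss X q i j = unitRow i j := by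
  induction q generalizing i j with
  | zero => omega
  | succ q ih =>
    have hq := h q (by omega)
    have ih := fun i => @ih (fun k hk => h k (by omega)) i
    rcases Nat.lt_succ_iff_lt_or_eq.1 hj with hj | rfl
    · have h0 : gauss X q q j = 0 := by
        rw [ih q hj, unitRow, if_neg (by omega)]
      simp only [gauss, gaussStep, h0, zero_div, mul_zero, sub_zero]
      split_ifs with hi
      · rw [unitRow, if_neg (by omega)]
      · exact ih i hj
    · simp only [gauss, gaussStep, div_self hq, mul_one, sub_self, unitRow]

/-- Row `k` influences the other rows only from its own step on. So the rows can be chosen one after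
another without spoiling earlier pivots. -/
theorem gauss_update {X : ℕ → ℕ → ℝ} {k : ℕ} (ρ : ℕ → ℝ) {q : ℕ} (hq : q ≤ k) {i : ℕ}
    (hi : i ≠ k) : gauss (Function.update X k ρ) q i = gauss X q i := by
  induction q generalizing i with
  | zero => simp [gauss, hi]
  | succ q ih =>
    funext j
    simp only [gauss, gaussStep, ih (by omega) hi, ih (by omega) (show q ≠ k by omega)]

/-- If no pivot vanishes, the last column ends up as the solution of the system. -/
theorem gauss_solution {m : ℕ} {X : ℕ → ℕ → ℝ} {p : ℕ → ℝ} (h : ∀ k < m, gauss X k k k ≠ 0)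
    (hp : ∀ i < m, dot m (X i) p = X i m) {i : ℕ} (hi : i < m) : gauss X m i m = p i := by
  -- Appending the coordinate `-1` to `p` turns the inhomogeneous system into a homogeneous one in
  -- `m + 1` variables.
  have hdot : ∀ a : ℕ → ℝ, dot (m + 1) a (Function.update p m (-1)) = dot m a p - a m := by
    intro a
    rw [dot, Finset.sum_range_succ, Function.update_self, dot, mul_neg_one, ← sub_eq_add_neg]
    congr 1
    refine Finset.sum_congr rfl fun j hj => ?_
    rw [Function.update_of_ne (Finset.mem_range.1 hj).ne]
  have h1 := (dot_gauss_eq_zero_iff (N := m + 1) (Function.update p m (-1)) le_rfl h).2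
    (fun i hi => by rw [hdot, hp i hi, sub_self]) i hi
  rw [hdot, sub_eq_zero] at h1
  rw [← h1, ← dot_unitRow hi p]
  exact Finset.sum_congr rfl fun j hj => by rw [gauss_column h i (Finset.mem_range.1 hj)]

/-- If the rows in `R` and the coordinate functions in `Z` have no common zero, then one can choose
a row for each step of the elimination, coordinate functions in their own place, in such a way that
no pivot vanishes. -/
theorem exists_pivots {m : ℕ} (Z : Set ℕ) (R : Set (ℕ → ℝ))
    (hR : ∀ v : ℕ → ℝ, (∀ j ≥ m, v j = 0) → (∀ j ∈ Z, v j = 0) →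
      (∀ ρ ∈ R, dot m ρ v = 0) → v = 0) :
    ∃ X : ℕ → ℕ → ℝ, (∀ i < m, (i ∈ Z ∧ X i = unitRow i) ∨ X i ∈ R) ∧
      ∀ k < m, gauss X k k k ≠ 0 := by
  -- Strengthened for the induction: every place in `Z` must receive its coordinate function. The
  -- case `q ∉ Z` below relies on this.
  suffices H : ∀ q ≤ m, ∃ X : ℕ → ℕ → ℝ,
      (∀ i < q, (i ∈ Z ∧ X i = unitRow i) ∨ (i ∉ Z ∧ X i ∈ R)) ∧
      ∀ k < q, gauss X k k k ≠ 0 by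
    obtain ⟨X, h1, h2⟩ := H m le_rfl
    exact ⟨X, fun i hi => (h1 i hi).imp id And.right, h2⟩
  intro q hq
  induction q with
  | zero => exact ⟨0, by simp, by simp⟩
  | succ q ih =>
    obtain ⟨X, hX, hpiv⟩ := ih (by omega)
    have hold : ∀ ρ, ∀ k < q, gauss (Function.update X q ρ) k k k ≠ 0 := fun ρ k hk => by
      rw [gauss_update ρ hk.le hk.ne]
      exact hpiv k hk
    have hnew : ∀ ρ, ((q ∈ Z ∧ ρ = unitRow q) ∨ (q ∉ Z ∧ ρ ∈ R)) →
        gauss (Function.update X q ρ) q q q ≠ 0 →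
        ∃ X : ℕ → ℕ → ℝ, (∀ i < q + 1, (i ∈ Z ∧ X i = unitRow i) ∨ (i ∉ Z ∧ X i ∈ R)) ∧
          ∀ k < q + 1, gauss X k k k ≠ 0 := by
      intro ρ hρ hne
      refine ⟨Function.update X q ρ, fun i hi => ?_, fun k hk => ?_⟩
      · rcases Nat.lt_succ_iff_lt_or_eq.1 hi with hi | rfl
        · rw [Function.update_of_ne hi.ne]
          exact hX i hi
        · rwa [Function.update_self]
      · rcases Nat.lt_succ_iff_lt_or_eq.1 hk with hk | rfl
        · exact hold ρ k hk
        · exact hne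
    by_contra hcon
    -- The kernel vector of the `q` rows chosen so far that has the coordinate `1` at `q` and
    -- vanishes beyond.
    set v : ℕ → ℝ := fun j => if j = q then 1 else if j < q then -gauss X q j q else 0 with hv
    have hdot : ∀ a : ℕ → ℝ, dot m a v = a q - ∑ j ∈ Finset.range q, a j * gauss X q j q := by
      intro a
      have h1 : dot m a v = dot (q + 1) a v := by
        refine (Finset.sum_subset (Finset.range_subset_range.2 hq) fun j _ hj => ?_).symm
        have : q + 1 ≤ j := by simpa using hj
        simp [hv, show j ≠ q by omega, show ¬ j < q by omega]
      rw [h1, dot, Finset.sum_range_succ, add_comm, sub_eq_add_neg, ← Finset.sum_neg_distrib]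
      refine congrArg₂ _ (by simp [hv]) (Finset.sum_congr rfl fun j hj => ?_)
      have hj := Finset.mem_range.1 hj
      simp [hv, hj, hj.ne]
    have hlow : ∀ ρ, ∀ i < q, dot m (gauss (Function.update X q ρ) q i) v = 0 := by
      intro ρ i hi
      rw [gauss_update ρ le_rfl hi.ne, hdot, sub_eq_zero,
        Finset.sum_eq_single_of_mem i (Finset.mem_range.2 hi)]
      · rw [gauss_column hpiv i hi, unitRow, if_pos rfl, one_mul]
      · intro j hj hji
        rw [gauss_column hpiv i (Finset.mem_range.1 hj), unitRow, if_neg hji.symm, zero_mul]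
    -- If `ρ` gives a zero pivot, its reduced row vanishes in the columns up to `q`, hence at `v`.
    -- The elimination preserves solutions, so `ρ` itself vanishes at `v`.
    have hrow : ∀ ρ, gauss (Function.update X q ρ) q q q = 0 → dot m ρ v = 0 := by
      intro ρ h0
      have := (dot_gauss_eq_zero_iff (N := m) (X := Function.update X q ρ) v
        (Nat.le_succ q) (hold ρ)).1 (fun i hi => ?_) q (Nat.lt_succ_self q)
      · rwa [Function.update_self] at this
      · rcases Nat.lt_succ_iff_lt_or_eq.1 hi with hi | rfl
        · exact hlow ρ i hi
        · rw [hdot, h0, zero_sub, neg_eq_zero]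
          refine Finset.sum_eq_zero fun j hj => ?_
          have hj := Finset.mem_range.1 hj
          rw [gauss_column (hold ρ) _ hj, unitRow, if_neg (by omega), zero_mul]
    have hvq : v q = 1 := by simp [hv]
    by_cases hqZ : q ∈ Z
    · by_cases h0 : gauss (Function.update X q (unitRow q)) q q q = 0
      · have := hrow _ h0
        rw [dot_unitRow (by omega), hvq] at this
        exact one_ne_zero this
      · exact hcon (hnew _ (.inl ⟨hqZ, rfl⟩) h0)
    -- If every row in `R` gave a zero pivot, then all of `R` would vanish at `v`. So do the
    -- coordinates in `Z`: those below `q` are rows already chosen, those above lie outside the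
    -- support of `v`. By `hR` this forces `v = 0`, against `v q = 1`.
    · have hv0 : v = 0 := by
        refine hR v (fun j hj => ?_) (fun j hj => ?_) fun ρ hρ => ?_
        · simp [hv, show j ≠ q by omega, show ¬ j < q by omega]
        · rcases lt_trichotomy j q with h | rfl | h
          · obtain ⟨-, h1⟩ | ⟨h1, -⟩ := hX j h
            · have h2 := (dot_gauss_eq_zero_iff (N := m) v le_rfl hpiv).1
                (fun i hi => by
                  have := hlow (X q) i hi
                  rwa [Function.update_eq_self] at this) j h
              rwa [h1, dot_unitRow (by omega)] at h2
            · exact absurd hj h1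
          · exact absurd hj hqZ
          · simp [hv, show j ≠ q by omega, show ¬ j < q by omega]
        · by_contra hne
          exact hcon (hnew ρ (.inr ⟨hqZ, hρ⟩) fun h0 => hne (hrow ρ h0))
      rw [hv0] at hvq
      exact zero_ne_one hvq

/-! ### Sizes of numbers -/

/-- The sets `G b` measure the sizes of numbers: they increase with `b`, and an arithmetic operation
adds the sizes of its arguments, and one. -/
structure Grading (G : ℕ → Set ℝ) : Prop where
  mono {a b : ℕ} : a ≤ b → G a ⊆ G b
  op (o : NOp) {x y : ℝ} {a b : ℕ} : x ∈ G a → y ∈ G b → o.apply x y ∈ G (a + b + 1)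
  zero : 0 ∈ G 1
  one : 1 ∈ G 1

theorem Grading.univ : Grading fun _ => Set.univ :=
  ⟨fun _ => subset_rfl, fun _ _ _ _ _ _ _ => trivial, trivial, trivial⟩

/-- Reducing a fraction only shrinks it, so any representation may be used to bound the digits. -/
theorem HasBits.of_fraction {b : ℕ} {q : ℚ} {x : ℤ} {y : ℕ} (hy : y ≠ 0) (hq : q = x / y)
    (hx : x.natAbs < 2 ^ b) (hyb : y < 2 ^ b) : HasBits b q := by
  have hdvd : (q.den : ℤ) ∣ y := by
    rw [hq]
    exact_mod_cast Rat.den_dvd x y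
  have hden : q.den ≤ y := Nat.le_of_dvd (Nat.pos_of_ne_zero hy) (by exact_mod_cast hdvd)
  have hnum : q.num ∣ x := by
    rw [hq]
    exact_mod_cast Rat.num_dvd x (by exact_mod_cast hy : (y : ℤ) ≠ 0)
  refine ⟨q, rfl, Nat.size_le.2 ?_, Nat.size_le.2 (hden.trans_lt hyb)⟩
  rcases eq_or_ne x 0 with rfl | hx0
  · have : q = 0 := by simp [hq]
    simp [this]
  · exact (Nat.le_of_dvd (Int.natAbs_pos.2 hx0) (Int.natAbs_dvd_natAbs.2 hnum)).trans_lt hx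

theorem HasBits.mono {a b : ℕ} (h : a ≤ b) {x : ℝ} : HasBits a x → HasBits b x :=
  fun ⟨q, hq, h1, h2⟩ => ⟨q, hq, h1.trans h, h2.trans h⟩

/-- A denominator has at least one digit. Rational data therefore have `B ≥ 1`, which makes room for
the constants `0` and `1`. -/
theorem HasBits.pos {b : ℕ} {x : ℝ} : HasBits b x → 0 < b :=
  fun ⟨q, _, _, h⟩ => (Nat.size_pos.2 q.pos).trans_le h

theorem Rat.add_natAbs_lt {a b : ℕ} {x y : ℤ} {d e : ℕ} (hx : x.natAbs < 2 ^ a)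
    (hy : y.natAbs < 2 ^ b) (hd : d < 2 ^ a) (he : e < 2 ^ b) :
    (x * e).natAbs + (y * d).natAbs < 2 ^ (a + b + 1) := by
  rw [Int.natAbs_mul, Int.natAbs_mul, Int.natAbs_natCast, Int.natAbs_natCast, pow_succ, pow_add]
  have h1 := Nat.mul_lt_mul'' hx he
  have h2 := Nat.mul_lt_mul'' hy hd
  rw [mul_comm (2 ^ b)] at h2
  omega

theorem HasBits.apply (o : NOp) {x y : ℝ} {a b : ℕ} (hx : HasBits a x) (hy : HasBits b y) :
    HasBits (a + b + 1) (o.apply x y) := by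
  obtain ⟨q, rfl, hq, hq'⟩ := hx
  obtain ⟨r, rfl, hr, hr'⟩ := hy
  rw [Nat.size_le] at hq hq' hr hr'
  have hqd : (q.den : ℚ) ≠ 0 := by exact_mod_cast q.den_ne_zero
  have hrd : (r.den : ℚ) ≠ 0 := by exact_mod_cast r.den_ne_zero
  have hqe : q = q.num / q.den := q.num_div_den.symm
  have hre : r = r.num / r.den := r.num_div_den.symm
  have hlt : 2 ^ a * 2 ^ b < 2 ^ (a + b + 1) := by
    rw [pow_succ, pow_add]
    have : 0 < 2 ^ a * 2 ^ b := by positivity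
    omega
  have hdd : q.den * r.den < 2 ^ (a + b + 1) := (Nat.mul_lt_mul'' hq' hr').trans hlt
  have hd0 : q.den * r.den ≠ 0 := mul_ne_zero q.den_ne_zero r.den_ne_zero
  have hsum := Rat.add_natAbs_lt hq hr hq' hr'
  cases o
  · have : HasBits (a + b + 1) ((q + r : ℚ) : ℝ) :=
      .of_fraction (x := q.num * r.den + r.num * q.den) hd0
        (by push_cast; conv_lhs => rw [hqe, hre]
            field_simp) ((Int.natAbs_add_le _ _).trans_lt hsum) hdd
    simpa [NOp.apply] using this
  · have : HasBits (a + b + 1) ((q - r : ℚ) : ℝ) :=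
      .of_fraction (x := q.num * r.den - r.num * q.den) hd0
        (by push_cast; conv_lhs => rw [hqe, hre]
            field_simp) ((Int.natAbs_sub_le _ _).trans_lt hsum) hdd
    simpa [NOp.apply] using this
  · have : HasBits (a + b + 1) ((q * r : ℚ) : ℝ) :=
      .of_fraction (x := q.num * r.num) hd0
        (by push_cast; conv_lhs => rw [hqe, hre]
            field_simp) (by rw [Int.natAbs_mul]; exact (Nat.mul_lt_mul'' hq hr).trans hlt) hdd
    simpa [NOp.apply] using this
  · have : HasBits (a + b + 1) ((q / r : ℚ) : ℝ) := by
      rcases eq_or_ne r.num 0 with h0 | h0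
      · rw [Rat.num_eq_zero.1 h0, div_zero]
        exact .of_fraction (x := 0) (y := 1) one_ne_zero (by simp) (by simp)
          (Nat.one_lt_two_pow (by omega))
      · have h0' : (r.num : ℚ) ≠ 0 := by exact_mod_cast h0
        -- The sign of the divisor moves to the numerator to keep the denominator a natural number.
        refine .of_fraction (x := q.num * r.den * r.num.sign) (y := q.den * r.num.natAbs)
          (mul_ne_zero q.den_ne_zero (Int.natAbs_ne_zero.2 h0)) ?_ ?_ ?_
        · have h1 : (r.num.natAbs : ℚ) = r.num.sign * r.num := by
            rw [Nat.cast_natAbs]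
            exact_mod_cast (Int.sign_mul_self_eq_abs r.num).symm
          have h2 : (r.num.sign : ℚ) ≠ 0 := by
            exact_mod_cast mt Int.sign_eq_zero_iff_zero.1 h0
          push_cast
          rw [h1]
          conv_lhs => rw [hqe, hre]
          field_simp
        · rw [Int.natAbs_mul, Int.natAbs_mul, Int.natAbs_sign_of_ne_zero h0, mul_one,
            Int.natAbs_natCast]
          exact (Nat.mul_lt_mul'' hq hr').trans hlt
        · exact (Nat.mul_lt_mul'' hq' hr).trans hlt
    simpa [NOp.apply] using this

theorem Grading.hasBits : Grading fun b => {x | HasBits b x} where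
  mono h _ := HasBits.mono h
  op o _ _ _ _ := HasBits.apply o
  zero := ⟨0, by simp, by simp, by simp⟩
  one := ⟨1, by simp, by simp, by simp⟩

/-- A bound on the sizes of the numbers after some steps of the elimination. -/
def stageGrade (B : ℕ) : ℕ → ℕ
  | 0 => 2 * B + 1
  | k + 1 => 4 * stageGrade B k + 3

/-- Adding one turns the recursion `g ↦ 4 * g + 3` into multiplication by `4`. -/
theorem stageGrade_succ (B k : ℕ) : stageGrade B k + 1 = 4 ^ k * (2 * B + 2) := by
  induction k with
  | zero => simp [stageGrade]
  | succ k ih => rw [pow_succ, mul_assoc, mul_left_comm, ← ih, stageGrade]; ring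

theorem stageGrade_mono (B : ℕ) : Monotone (stageGrade B) :=
  monotone_nat_of_le_succ fun k => by rw [stageGrade]; omega

namespace Grading

variable {G : ℕ → Set ℝ}

/-- From size `g`, the quotient has size `2 * g + 1`, its product with an entry `3 * g + 2`, and the
difference `4 * g + 3`. -/
theorem gauss_mem (hG : Grading G) {B : ℕ} {X : ℕ → ℕ → ℝ} (hX : ∀ i j, X i j ∈ G (2 * B + 1)) (k i j : ℕ) :
    gauss X k i j ∈ G (stageGrade B k) := by
  induction k generalizing i j with
  | zero => exact hX i j
  | succ k ih =>
    have h1 := hG.op .div (ih k j) (ih k k)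
    simp only [gauss, gaussStep, stageGrade]
    split_ifs
    · exact hG.mono (by omega) h1
    · exact hG.mono (by omega) (hG.op .sub (ih i j) (hG.op .mul (ih i k) h1))

/-- Each term adds the size `a + b + 1` of its product and one for the addition; the leading `1` is
the size of the empty sum. -/
theorem sum_mem (hG : Grading G) {f g : ℕ → ℝ} {a b : ℕ} {k : ℕ} (hf : ∀ i < k, f i ∈ G a)
    (hg : ∀ i < k, g i ∈ G b) : ∑ i ∈ Finset.range k, f i * g i ∈ G (1 + k * (a + b + 2)) := by
  induction k with
  | zero => simpa using hG.zero
  | succ k ih =>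
    rw [Finset.sum_range_succ]
    refine hG.mono ?_ (hG.op .add (ih (fun i hi => hf i (by omega)) fun i hi => hg i (by omega))
      (hG.op .mul (hf k (by omega)) (hg k (by omega))))
    rw [add_mul]
    omega

end Grading

/-! ### Candidate contracts from the digits of a number -/

namespace Setting

variable {ℓ n m : ℕ} (I : Setting ℓ n m)

theorem input_F (θ : Fin ℓ) (a : Fin n) (ω : Fin m) :
    I.input.num 0 (θ * (n * m) + (a * m + ω)) = I.F θ a ω := by
  have hk : (θ * (n * m) + (a * m + ω) : ℕ) =
      (finProdFinEquiv (θ, finProdFinEquiv (a, ω)) : Fin (ℓ * (n * m))) := by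
    simp [finProdFinEquiv]
    ring
  have h : (θ * (n * m) + (a * m + ω) : ℕ) < ℓ * (n * m) := hk ▸ Fin.isLt _
  have hf : (⟨_, h⟩ : Fin (ℓ * (n * m))) = finProdFinEquiv (θ, finProdFinEquiv (a, ω)) :=
    Fin.ext hk
  simp only [input, if_true, dif_pos h, hf, Equiv.symm_apply_apply]

theorem input_c (θ : Fin ℓ) (a : Fin n) : I.input.num 1 (θ * n + a) = I.c θ a := by
  have hk : (θ * n + a : ℕ) = (finProdFinEquiv (θ, a) : Fin (ℓ * n)) := by
    simp [finProdFinEquiv]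
    ring
  have h : (θ * n + a : ℕ) < ℓ * n := hk ▸ Fin.isLt _
  have hf : (⟨_, h⟩ : Fin (ℓ * n)) = finProdFinEquiv (θ, a) := Fin.ext hk
  simp only [input, one_ne_zero, if_false, if_true, dif_pos h, hf, Equiv.symm_apply_apply]

theorem input_μ (θ : Fin ℓ) : I.input.num 2 θ = I.μ θ := by
  simp [input]

theorem input_r (ω : Fin m) : I.input.num 3 ω = I.r ω := by
  simp [input]

theorem input_num_mem {G : ℕ → Set ℝ} (hG : Grading G) {B : ℕ} (hB : 1 ≤ B)
    (hF : ∀ θ a ω, I.F θ a ω ∈ G B) (hc : ∀ θ a, I.c θ a ∈ G B) (hμ : ∀ θ, I.μ θ ∈ G B)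
    (hr : ∀ ω, I.r ω ∈ G B) (x i : ℕ) : I.input.num x i ∈ G B := by
  have h0 : 0 ∈ G B := hG.mono hB hG.zero
  unfold input
  dsimp only
  split_ifs
  exacts [hF _ _ _, h0, hc _ _, h0, hμ _, h0, hr _, h0, h0]

theorem types_pos (I : Setting ℓ n m) : 0 < ℓ := by
  rcases Nat.eq_zero_or_pos ℓ with rfl | h
  · simpa using I.μ_mem.2
  · exact h

theorem actions_pos (I : Setting ℓ n m) : 0 < n := I.exists_free.choose.pos

theorem outcomes_pos (I : Setting ℓ n m) : 0 < m := by
  rcases Nat.eq_zero_or_pos m with rfl | h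
  · simpa using (I.F_mem ⟨0, I.types_pos⟩ I.exists_free.choose).2
  · exact h

/-- The linear equation with the number `e`, written in the row `i` of a table whose column `m` is
the right-hand side: for `e = 0`, the payment `i` vanishes; otherwise, two actions give an agent's
type the same utility. -/
noncomputable def equation (e i j : ℕ) : ℝ :=
  if e = 0 then unitRow i j
  else if j < m then
    I.input.num 0 ((e - 1) / (n * n) * (n * m) + ((e - 1) / n % n * m + j)) -
      I.input.num 0 ((e - 1) / (n * n) * (n * m) + ((e - 1) % n * m + j))
  else
    I.input.num 1 ((e - 1) / (n * n) * n + (e - 1) / n % n) -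
      I.input.num 1 ((e - 1) / (n * n) * n + (e - 1) % n)

/-- The number of an equation between the utilities of two actions. -/
def equationCode (θ : Fin ℓ) (a a' : Fin n) : ℕ := θ * (n * n) + (a * n + a') + 1

theorem equationCode_pos (θ : Fin ℓ) (a a' : Fin n) : 0 < equationCode θ a a' :=
  Nat.succ_pos _

theorem equationCode_lt (θ : Fin ℓ) (a a' : Fin n) :
    equationCode θ a a' < ℓ * (n * n) + 1 := by
  have h : (θ * (n * n) + (a * n + a') : ℕ) =
      (finProdFinEquiv (θ, finProdFinEquiv (a, a')) : Fin (ℓ * (n * n))) := by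
    simp [finProdFinEquiv]
    ring
  exact Nat.succ_lt_succ (h ▸ Fin.isLt _)

theorem equationCode_decode (θ : Fin ℓ) (a a' : Fin n) :
    (equationCode θ a a' - 1) / (n * n) = θ ∧ (equationCode θ a a' - 1) / n % n = a ∧
      (equationCode θ a a' - 1) % n = a' := by
  have hn : 0 < n := a.pos
  have h1 : (a * n + a' : ℕ) / n = a := by
    rw [add_comm, Nat.add_mul_div_right _ _ hn, Nat.div_eq_of_lt a'.2, zero_add]
  have h2 : (θ * (n * n) + (a * n + a') : ℕ) / n = θ * n + a := by
    rw [← mul_assoc, ← add_assoc, ← add_mul, add_comm, Nat.add_mul_div_right _ _ hn,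
      Nat.div_eq_of_lt a'.2, zero_add]
  simp only [equationCode, Nat.add_sub_cancel]
  refine ⟨?_, ?_, ?_⟩
  · rw [← Nat.div_div_eq_div_mul, h2, add_comm, Nat.add_mul_div_right _ _ hn,
      Nat.div_eq_of_lt a.2, zero_add]
  · rw [h2, add_comm, Nat.add_mul_mod_self_right, Nat.mod_eq_of_lt a.2]
  · rw [← mul_assoc, ← add_assoc, ← add_mul, add_comm, Nat.add_mul_mod_self_right,
      Nat.mod_eq_of_lt a'.2]

theorem equation_code_of_lt (θ : Fin ℓ) (a a' : Fin n) (i : ℕ) (ω : Fin m) :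
    I.equation (equationCode θ a a') i ω = I.F θ a ω - I.F θ a' ω := by
  obtain ⟨h1, h2, h3⟩ := equationCode_decode θ a a'
  rw [equation, if_neg (equationCode_pos θ a a').ne', if_pos ω.2, h1, h2, h3, input_F, input_F]

theorem equation_code_last (θ : Fin ℓ) (a a' : Fin n) (i : ℕ) :
    I.equation (equationCode θ a a') i m = I.c θ a - I.c θ a' := by
  obtain ⟨h1, h2, h3⟩ := equationCode_decode θ a a'
  rw [equation, if_neg (equationCode_pos θ a a').ne', if_neg (lt_irrefl m), h1, h2, h3, input_c, input_c]

theorem dot_equation_code (θ : Fin ℓ) (a a' : Fin n) (i : ℕ) (v : ℕ → ℝ) :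
    dot m (I.equation (equationCode θ a a') i) v =
      I.payment (fun ω => v ω) θ a - I.payment (fun ω => v ω) θ a' := by
  rw [dot, Finset.sum_range, payment, payment, ← Finset.sum_sub_distrib]
  exact Finset.sum_congr rfl fun ω _ => by rw [equation_code_of_lt, sub_mul]

theorem equation_mem {G : ℕ → Set ℝ} (hG : Grading G) {B : ℕ}
    (hI : ∀ x i, I.input.num x i ∈ G B) (e i j : ℕ) : I.equation e i j ∈ G (2 * B + 1) := by
  rw [two_mul]
  unfold equation unitRow
  split_ifs
  exacts [hG.mono (by omega) hG.one, hG.mono (by omega) hG.zero, hG.op .sub (hI _ _) (hI _ _),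
    hG.op .sub (hI _ _) (hI _ _)]

/-- The table of the equations whose numbers are the digits of `K`. -/
noncomputable def table (K : ℕ) : ℕ → ℕ → ℝ := fun i j =>
  I.equation (K / (ℓ * (n * n) + 1) ^ i % (ℓ * (n * n) + 1)) i j

/-- The contract that the elimination yields for the table with the number `K`, negative payments
being replaced by zero. -/
noncomputable def contract (K : ℕ) : ℕ → ℝ := fun i => max (gauss (I.table K) m i m) 0

theorem contract_mem {G : ℕ → Set ℝ} (hG : Grading G) {B : ℕ}
    (hI : ∀ x i, I.input.num x i ∈ G B) (K i : ℕ) : I.contract K i ∈ G (stageGrade B m) := by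
  rcases max_choice (gauss (I.table K) m i m) 0 with h | h
  · rw [contract, h]
    exact hG.gauss_mem (fun i j => I.equation_mem hG hI _ i j) m i m
  · rw [contract, h]
    exact hG.mono (le_add_self.trans (stageGrade_mono B (Nat.zero_le m))) hG.zero

end Setting

theorem gauss_congr {m : ℕ} {X Y : ℕ → ℕ → ℝ} (h : ∀ i < m, X i = Y i) {q : ℕ} (hq : q ≤ m)
    {i : ℕ} (hi : i < m) : gauss X q i = gauss Y q i := by
  induction q generalizing i with
  | zero => exact h i hi
  | succ q ih =>
    funext j
    simp only [gauss, gaussStep, ih (by omega) hi, ih (by omega) (show q < m by omega)]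

namespace Setting

variable {ℓ n m : ℕ} (I : Setting ℓ n m)

/-- Every candidate is the contract with some number. -/
theorem exists_contract_eq {p : Fin m → ℝ} (hp : p ∈ I.candidates) :
    ∃ K < (ℓ * (n * n) + 1) ^ m, ∀ ω : Fin m, I.contract K ω = p ω := by
  obtain ⟨b, ⟨hp0, hIC⟩, hbas⟩ := I.mem_candidates.1 hp
  set p' : ℕ → ℝ := fun j => if h : j < m then p ⟨j, h⟩ else 0 with hp'
  have hpp : ∀ ω : Fin m, p' ω = p ω := fun ω => by simp [hp']
  -- The available rows are the constraints tight at `p`: vanishing payments as coordinate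
  -- functions, and indifference between the action `b θ` and another one. They have no common zero
  -- because `p` is basic.
  obtain ⟨X, hX, hpiv⟩ := exists_pivots (m := m) {j | p' j = 0}
    {ρ | ∃ θ a', I.agentUtility p θ a' = I.agentUtility p θ (b θ) ∧
      ρ = I.equation (equationCode θ (b θ) a') 0} (by
    intro v hv hZ hR
    have h0 : (fun ω : Fin m => v ω) = 0 := by
      refine hbas _ fun i hi => ?_
      rcases i with ω | ⟨θ, a'⟩
      · exact hZ ω ((hpp ω).trans hi)
      · have h1 := hR _ ⟨θ, a', ?_, rfl⟩
        · rw [dot_equation_code] at h1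
          simpa [conL, profileCon] using h1
        · simp only [profileCon, Sum.map_inr, conL, conB, LinearMap.sub_apply,
            paymentL_apply] at hi
          simp only [agentUtility]
          linarith
    funext j
    by_cases hj : j < m
    · exact congrFun h0 ⟨j, hj⟩
    · exact hv j (by omega))
  have hdig : ∀ i : Fin m, ∃ e : Fin (ℓ * (n * n) + 1), I.equation e i = X i ∧
      dot m (X i) p' = X i m := by
    intro i
    rcases hX i i.2 with ⟨hi, h⟩ | ⟨θ, a', ht, h⟩
    -- The digit `0` denotes the coordinate function of its own row only. This is why
    -- `exists_pivots` keeps coordinate functions in place.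
    · refine ⟨0, by funext j; simp [equation, h], ?_⟩
      rw [h, dot_unitRow i.2, unitRow, if_neg i.2.ne]
      exact hi
    · refine ⟨⟨_, equationCode_lt θ (b θ) a'⟩, ?_, ?_⟩
      · rw [h]
        funext j
        simp [equation, equationCode]
      · rw [h, dot_equation_code, equation_code_last]
        simp only [hpp]
        simp only [agentUtility] at ht
        linarith
  choose e he hdot using hdig
  -- The number of the candidate has the chosen equations as its digits.
  have htab : ∀ i < m, I.table (finFunctionFinEquiv e) i = X i := by
    intro i hi
    have h1 := finFunctionFinEquiv_symm_apply_val (finFunctionFinEquiv e) ⟨i, hi⟩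
    rw [Equiv.symm_apply_apply] at h1
    rw [← he ⟨i, hi⟩, h1]
    rfl
  refine ⟨finFunctionFinEquiv e, Fin.isLt _, fun ω => ?_⟩
  rw [contract, gauss_congr htab le_rfl ω.2,
    gauss_solution hpiv (fun i hi => hdot ⟨i, hi⟩) ω.2, hpp, max_eq_left (hp0 ω)]

end Setting

/-! ### The program

Word arrays: `0` sizes, `1` powers of the number of equations, `2` the number of equations, `3` the
number of the contract, `4`–`7` local variables.  Number arrays: `0`–`3` data, `4` best contract,
`5` tables of the elimination, `6` contract, `7`–`14` local variables, `15` value of the contract,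
`16` value of the best contract. -/

namespace Prog

open WExp (lit read var)

/-- The number of types. -/
def types : WExp := read 0 (lit 0)

/-- The number of actions. -/
def actions : WExp := read 0 (lit 1)

/-- The number of outcomes. -/
def outcomes : WExp := read 0 (lit 2)

/-- A variable for a number. -/
def cell (x : ℕ) : NRef := ⟨x, lit 0⟩

/-- Compute the number of equations and its powers. -/
def powers : Cmd :=
  .seq (.setW 2 (lit 0) (types * (actions * actions) + lit 1)) <|
  .seq (.setW 1 (lit 0) (lit 1)) <|
  .count 4 outcomes (.setW 1 (var 4 + lit 1) (read 1 (var 4) * var 2))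

/-- Find the row, the column and the number of the equation of an entry of the table. -/
def locate : Cmd :=
  .seq (.setW 5 (lit 0) (var 4 / (outcomes + lit 1))) <|
  .seq (.setW 6 (lit 0) (var 4 % (outcomes + lit 1)))
    (.setW 7 (lit 0) (var 3 / read 1 (var 5) % var 2))

/-- Compute an entry of the table. -/
def entry : Cmd :=
  .ite (.weq (var 7) (lit 0))
    (.ite (.weq (var 5) (var 6)) (.const ⟨5, var 4⟩ 1) (.const ⟨5, var 4⟩ 0))
    (.ite (.wlt (var 6) outcomes)
      (.op .sub ⟨5, var 4⟩
        ⟨0, (var 7 - lit 1) / (actions * actions) * (actions * outcomes) +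
          ((var 7 - lit 1) / actions % actions * outcomes + var 6)⟩
        ⟨0, (var 7 - lit 1) / (actions * actions) * (actions * outcomes) +
          ((var 7 - lit 1) % actions * outcomes + var 6)⟩)
      (.op .sub ⟨5, var 4⟩
        ⟨1, (var 7 - lit 1) / (actions * actions) * actions +
          (var 7 - lit 1) / actions % actions⟩
        ⟨1, (var 7 - lit 1) / (actions * actions) * actions + (var 7 - lit 1) % actions⟩))

/-- Write the table of the equations. -/
def build : Cmd := .count 4 (outcomes * (outcomes + lit 1)) (.seq locate entry)

/-- Find the step, the row and the column of an entry of the successive tables. -/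
def locateStage : Cmd :=
  .seq (.setW 5 (lit 0) (var 4 / (outcomes * (outcomes + lit 1)))) <|
  .seq (.setW 6 (lit 0) (var 4 % (outcomes * (outcomes + lit 1)) / (outcomes + lit 1)))
    (.setW 7 (lit 0) (var 4 % (outcomes + lit 1)))

/-- Compute an entry of the next table. -/
def entryStage : Cmd :=
  .seq (.op .div (cell 7)
    ⟨5, var 5 * (outcomes * (outcomes + lit 1)) + (var 5 * (outcomes + lit 1) + var 7)⟩
    ⟨5, var 5 * (outcomes * (outcomes + lit 1)) + (var 5 * (outcomes + lit 1) + var 5)⟩) <|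
  .ite (.weq (var 6) (var 5))
    (.copy ⟨5, var 4 + outcomes * (outcomes + lit 1)⟩ (cell 7))
    (.seq (.op .mul (cell 8)
        ⟨5, var 5 * (outcomes * (outcomes + lit 1)) + (var 6 * (outcomes + lit 1) + var 5)⟩
        (cell 7))
      (.op .sub ⟨5, var 4 + outcomes * (outcomes + lit 1)⟩ ⟨5, var 4⟩ (cell 8)))

/-- Compute all the tables of the elimination. -/
def eliminate : Cmd :=
  .count 4 (outcomes * (outcomes * (outcomes + lit 1))) (.seq locateStage entryStage)

/-- Extract the contract from the last table. -/
def extract : Cmd :=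
  .seq (.const (cell 7) 0) <|
  .count 4 outcomes <|
  .seq (.copy ⟨6, var 4⟩ ⟨5, outcomes * (outcomes * (outcomes + lit 1)) +
    (var 4 * (outcomes + lit 1) + outcomes)⟩) <|
  .ite (.nlt ⟨6, var 4⟩ (cell 7)) (.const ⟨6, var 4⟩ 0) .skip

/-- Compute the expected payment and the expected reward. -/
def accumulate : Cmd :=
  .seq (.const (cell 9) 0) <| .seq (.const (cell 10) 0) <|
  .count 6 outcomes <|
  .seq (.op .mul (cell 8)
    ⟨0, var 4 * (actions * outcomes) + (var 5 * outcomes + var 6)⟩ ⟨6, var 6⟩) <|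
  .seq (.op .add (cell 9) (cell 9) (cell 8)) <|
  .seq (.op .mul (cell 8)
    ⟨0, var 4 * (actions * outcomes) + (var 5 * outcomes + var 6)⟩ ⟨3, var 6⟩)
    (.op .add (cell 10) (cell 10) (cell 8))

/-- Compute the utilities of the agent and of the principal. -/
def utilities : Cmd :=
  .seq accumulate <|
  .seq (.op .sub (cell 11) (cell 9) ⟨1, var 4 * actions + var 5⟩)
    (.op .sub (cell 12) (cell 10) (cell 9))

/-- The current action is the first one, or is better than the best one so far. -/
def isBetter : Test :=
  .not (.and (.not (.weq (var 5) (lit 0))) (.and (.not (.nlt (cell 13) (cell 11)))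
    (.not (.and (.not (.nlt (cell 11) (cell 13))) (.nlt (cell 14) (cell 12))))))

/-- Find the utilities for the action that the current type takes. -/
def bestAction : Cmd :=
  .count 5 actions <|
  .seq utilities <|
  .ite isBetter (.seq (.copy (cell 13) (cell 11)) (.copy (cell 14) (cell 12))) .skip

/-- Compute the overall utility of the principal. -/
def evaluate : Cmd :=
  .seq (.const (cell 15) 0) <|
  .count 4 types <|
  .seq bestAction <|
  .seq (.op .mul (cell 8) ⟨2, var 4⟩ (cell 14)) (.op .add (cell 15) (cell 15) (cell 8))

/-- Keep the contract if it is the best one so far. -/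
def keep : Cmd :=
  .ite (.nlt (cell 16) (cell 15))
    (.seq (.copy (cell 16) (cell 15)) (.count 4 outcomes (.copy ⟨4, var 4⟩ ⟨6, var 4⟩)))
    .skip

/-- Find the best one among all the contracts given by the tables of equations. -/
def search : Cmd :=
  .seq powers <| .count 3 (read 1 outcomes) <|
  .seq build <| .seq eliminate <| .seq extract <| .seq evaluate keep

/-- With a single action, the zero contract is optimal; otherwise, search for the best one. -/
def main : Cmd := .ite (.weq actions (lit 1)) .skip search

end Prog

/-! ### Correctness of the program -/

/-- The sizes and the data of the instance are in memory. -/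
structure Ready {ℓ n m : ℕ} (I : Setting ℓ n m) (s : State) : Prop where
  word : s.word 0 = I.input.word 0
  num : ∀ x < 4, s.num x = I.input.num x

/-- The bound `V` on words leaves enough room. -/
structure Room (ℓ n m V : ℕ) : Prop where
  pow : (ℓ * (n * n) + 1) ^ m ≤ V
  table : m * (m * (m + 1)) ≤ V
  ℓ_pos : 0 < ℓ
  n_pos : 0 < n
  m_pos : 0 < m

namespace Room

variable {ℓ n m V : ℕ}

theorem row (h : Room ℓ n m V) : m * (m + 1) ≤ V :=
  (Nat.le_mul_of_pos_left _ h.m_pos).trans h.table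

theorem succ_m (h : Room ℓ n m V) : m + 1 ≤ V := (Nat.le_mul_of_pos_left _ h.m_pos).trans h.row

theorem base (h : Room ℓ n m V) : ℓ * (n * n) + 1 ≤ V :=
  (Nat.le_self_pow h.m_pos.ne' _).trans h.pow

theorem le_ℓ (h : Room ℓ n m V) : ℓ ≤ V :=
  ((Nat.le_mul_of_pos_right _ (Nat.mul_pos h.n_pos h.n_pos)).trans (Nat.le_succ _)).trans h.base

theorem le_n (h : Room ℓ n m V) : n ≤ V :=
  ((Nat.le_mul_of_pos_left _ h.n_pos).trans
    ((Nat.le_mul_of_pos_left _ h.ℓ_pos).trans (Nat.le_succ _))).trans h.base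

end Room

namespace Ready

variable {ℓ n m : ℕ} {I : Setting ℓ n m} {s s' : State}

theorem frame {ws ns : List ℕ} (h : Ready I s) (hf : Frame ws ns s s') (hw : 0 ∉ ws)
    (hn : ∀ x < 4, x ∉ ns) : Ready I s' :=
  ⟨(hf.word 0 hw).trans h.word, fun x hx => (hf.num x (hn x hx)).trans (h.num x hx)⟩

theorem types (h : Ready I s) : Prog.types.eval s = ℓ := by
  simp [Prog.types, h.word, Setting.input]

theorem actions (h : Ready I s) : Prog.actions.eval s = n := by
  simp [Prog.actions, h.word, Setting.input]

theorem outcomes (h : Ready I s) : Prog.outcomes.eval s = m := by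
  simp [Prog.outcomes, h.word, Setting.input]

end Ready

/-- The number of equations and its powers are in memory. -/
structure HasPowers (ℓ n m : ℕ) (s : State) : Prop where
  base : s.word 2 0 = ℓ * (n * n) + 1
  pow : ∀ i ≤ m, s.word 1 i = (ℓ * (n * n) + 1) ^ i

theorem HasPowers.frame {ℓ n m : ℕ} {s s' : State} {ws ns : List ℕ} (h : HasPowers ℓ n m s)
    (hf : Frame ws ns s s') (h1 : 1 ∉ ws) (h2 : 2 ∉ ws) : HasPowers ℓ n m s' :=
  ⟨by rw [hf.word 2 h2, h.base], fun i hi => by rw [hf.word 1 h1, h.pow i hi]⟩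

namespace Prog

open WExp

variable {ℓ n m : ℕ} {I : Setting ℓ n m} {G : ℕ → Set ℝ} {V B g : ℕ} {s : State}

@[simp] theorem cell_get (x : ℕ) (s : State) : (cell x).get s = s.num x 0 := rfl

@[simp] theorem cell_arr (x : ℕ) : (cell x).arr = x := rfl

@[simp] theorem cell_addr (x : ℕ) (s : State) : (cell x).addr.eval s = 0 := rfl

theorem powers_runs {A : Set ℝ} (hV : Room ℓ n m V) (hs : Ready I s) :
    Runs V A powers s (HasPowers ℓ n m) := by
  have hbase : ∀ {i}, i ≤ m → (ℓ * (n * n) + 1) ^ i ≤ V := fun hi =>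
    (Nat.pow_le_pow_right (Nat.succ_pos _) hi).trans hV.pow
  refine .seq (.setW ?_ (.seq (.setW ?_ ?_)))
  · simpa [hs.types, hs.actions] using hV.base
  · simpa using hbase (Nat.zero_le m)
  · simp only [eval_lit, eval_add, eval_mul, hs.types, hs.actions]
    refine (Runs.count (b := m) (fun k s' => s'.word 2 0 = ℓ * (n * n) + 1 ∧
      ∀ i ≤ k, s'.word 1 i = (ℓ * (n * n) + 1) ^ i) ((Nat.le_succ m).trans hV.succ_m) (by decide)
      ?_ ?_ ?_).conseq fun s' _ h => ⟨h.1, h.2⟩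
    · intro s' hf
      refine Ready.outcomes (I := I) ⟨?_, ?_⟩
      · funext i
        rw [hf.word 0 (by decide)]
        simpa using congrFun hs.word i
      · intro x hx
        rw [hf.num x (by simp [Cmd.nmods])]
        exact hs.num x hx
    · simp
    · intro k hk s' hf h4 ⟨h2, h1⟩
      refine .setW ?_ ?_
      · simp only [eval_mul, eval_read, eval_var, h4, h2, h1 k le_rfl, ← pow_succ]
        exact hbase hk
      · simp only [eval_mul, eval_read, eval_var, eval_add, eval_lit, h4, h2, h1 k le_rfl,
          ← pow_succ, State.putW_word]
        refine ⟨by simp, fun i hi => ?_⟩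
        rcases Nat.le_succ_iff_eq_or_le.1 hi with rfl | hi
        · simp
        · simp [show i ≠ k + 1 by omega, h1 i hi]

theorem locate_runs {A : Set ℝ} (hV : Room ℓ n m V) (hs : Ready I s) (hp : HasPowers ℓ n m s)
    {q K : ℕ} (hq : q < m * (m + 1)) (h4 : s.word 4 0 = q) (h3 : s.word 3 0 = K) :
    Runs V A locate s fun s' => s'.word 5 0 = q / (m + 1) ∧ s'.word 6 0 = q % (m + 1) ∧
      s'.word 7 0 = K / (ℓ * (n * n) + 1) ^ (q / (m + 1)) % (ℓ * (n * n) + 1) := by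
  have ho := hs.outcomes
  have h5 : q / (m + 1) ≤ m := (Nat.div_lt_of_lt_mul (by rwa [mul_comm])).le
  simp only [outcomes, eval_read, eval_lit] at ho
  refine .seq (.setW ?_ (.seq (.setW ?_ (.setW ?_ ?_))))
  · simp [h4, outcomes, ho]
    exact (h5.trans (Nat.le_succ m)).trans hV.succ_m
  · simp [h4, outcomes, ho]
    exact (Nat.mod_lt _ (Nat.succ_pos m)).le.trans hV.succ_m
  · simp [h4, outcomes, ho, h3, hp.base, hp.pow _ h5]
    exact (Nat.mod_lt _ (Nat.succ_pos _)).le.trans hV.base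
  · simp [h4, outcomes, ho, h3, hp.base, hp.pow _ h5]

theorem entry_runs (hG : Grading G) (hI : ∀ x i, I.input.num x i ∈ G B) (hg : 2 * B + 1 ≤ g)
    (hs : Ready I s) :
    Runs V (G g) entry s fun s' =>
      s'.num 5 = Function.update (s.num 5) (s.word 4 0)
        (I.equation (s.word 7 0) (s.word 5 0) (s.word 6 0)) := by
  have ho := hs.outcomes
  have ha := hs.actions
  have hE := hG.mono hg (I.equation_mem hG hI (s.word 7 0) (s.word 5 0) (s.word 6 0))
  refine .ite (fun h7 => .ite (fun h5 => ?_) fun h5 => ?_) fun h7 => .ite (fun h6 => ?_) fun h6 => ?_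
  all_goals
    simp only [Test.Holds, eval_var, eval_lit, ho] at *
    simp only [Setting.equation, unitRow, *, if_true, if_false] at hE ⊢
  · refine .const (by simpa using hE) ?_
    simp [State.putN]
  · refine .const (by simpa using hE) ?_
    simp [State.putN]
  all_goals
    have hh : ∀ x < 4, ∀ i, s.num x i = I.input.num x i := fun x hx i => congrFun (hs.num x hx) i
    refine .op ?_ ?_
    · simpa [NOp.apply, NRef.get, hh, ha, hs.outcomes] using hE
    · simp [State.putN, NOp.apply, NRef.get, hh, ha, hs.outcomes]

theorem build_runs (hG : Grading G) (hI : ∀ x i, I.input.num x i ∈ G B) (hg : 2 * B + 1 ≤ g)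
    (hV : Room ℓ n m V) (hs : Ready I s) (hp : HasPowers ℓ n m s) {K : ℕ} (h3 : s.word 3 0 = K) :
    Runs V (G g) build s fun s' =>
      ∀ a < m * (m + 1), s'.num 5 a = I.table K (a / (m + 1)) (a % (m + 1)) := by
  refine Runs.count (fun q s' => ∀ a < q, s'.num 5 a = I.table K (a / (m + 1)) (a % (m + 1)))
    hV.row (by decide) ?_ (by simp) ?_
  · intro s' hf
    have hs' : Ready I s' := hs.frame hf (by decide) (by decide)
    simp [hs'.outcomes]
  · intro q hq s' hf h4 ih
    have hs' : Ready I s' := hs.frame hf (by decide) (by decide)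
    have hp' : HasPowers ℓ n m s' := hp.frame hf (by decide) (by decide)
    have h3' : s'.word 3 0 = K := by rw [hf.word 3 (by decide), h3]
    refine .seq ((locate_runs hV hs' hp' hq h4 h3').conseq fun s₁ hf₁ ⟨h5, h6, h7⟩ => ?_)
    have hs₁ : Ready I s₁ := hs'.frame hf₁ (by decide) (by decide)
    refine (entry_runs hG hI hg hs₁).conseq fun s₂ _ h a haq => ?_
    rw [State.putW_num, h, hf₁.word 4 (by decide), hf₁.num 5 (by decide), h4]
    rcases Nat.lt_succ_iff_lt_or_eq.1 haq with haq | rfl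
    · rw [Function.update_of_ne haq.ne, ih a haq]
    · rw [Function.update_self, h5, h6, h7, Setting.table]

end Prog

/-! ### The elimination phase: all intermediate tables in one array -/

namespace Setting

variable {ℓ n m : ℕ} (I : Setting ℓ n m)

/-- The successive tables of the elimination, written one after the other. -/
noncomputable def stages (K a : ℕ) : ℝ :=
  gauss (I.table K) (a / (m * (m + 1))) (a % (m * (m + 1)) / (m + 1)) (a % (m + 1))

theorem entry_lt {i j : ℕ} (hi : i < m) (hj : j < m + 1) : i * (m + 1) + j < m * (m + 1) :=
  calc i * (m + 1) + j < (i + 1) * (m + 1) := by rw [add_mul, one_mul]; omega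
    _ ≤ m * (m + 1) := Nat.mul_le_mul_right _ hi

theorem stages_address (K k : ℕ) {i j : ℕ} (hi : i < m) (hj : j < m + 1) :
    I.stages K (k * (m * (m + 1)) + (i * (m + 1) + j)) = gauss (I.table K) k i j := by
  have hr := entry_lt hi hj
  have h1 : (k * (m * (m + 1)) + (i * (m + 1) + j)) / (m * (m + 1)) = k := by
    rw [add_comm, Nat.add_mul_div_right _ _ (by omega), Nat.div_eq_of_lt hr, zero_add]
  have h2 : (k * (m * (m + 1)) + (i * (m + 1) + j)) % (m * (m + 1)) = i * (m + 1) + j := by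
    rw [add_comm, Nat.add_mul_mod_self_right, Nat.mod_eq_of_lt hr]
  have h3 : (i * (m + 1) + j) / (m + 1) = i := by
    rw [add_comm, Nat.add_mul_div_right _ _ (Nat.succ_pos m), Nat.div_eq_of_lt hj, zero_add]
  have h4 : (k * (m * (m + 1)) + (i * (m + 1) + j)) % (m + 1) = j := by
    rw [← mul_assoc, ← add_assoc, ← add_mul, add_comm, Nat.add_mul_mod_self_right,
      Nat.mod_eq_of_lt hj]
  rw [stages, h1, h2, h3, h4]

end Setting

namespace Prog

open WExp

variable {ℓ n m : ℕ} {I : Setting ℓ n m} {G : ℕ → Set ℝ} {V B g : ℕ} {s : State}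

theorem locateStage_runs {A : Set ℝ} (hV : Room ℓ n m V) (hs : Ready I s)
    {q : ℕ} (hq : q < m * (m * (m + 1))) (h4 : s.word 4 0 = q) :
    Runs V A locateStage s fun s' => s'.word 5 0 = q / (m * (m + 1)) ∧
      s'.word 6 0 = q % (m * (m + 1)) / (m + 1) ∧ s'.word 7 0 = q % (m + 1) := by
  have ho := hs.outcomes
  have hqV : q ≤ V := hq.le.trans hV.table
  simp only [outcomes, eval_read, eval_lit] at ho
  refine .seq (.setW ?_ (.seq (.setW ?_ (.setW ?_ ?_))))
  · simp [h4, outcomes, ho]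
    exact (Nat.div_le_self _ _).trans hqV
  · simp [h4, outcomes, ho]
    exact ((Nat.div_le_self _ _).trans (Nat.mod_le _ _)).trans hqV
  · simp [h4, outcomes, ho]
    exact (Nat.mod_le _ _).trans hqV
  · simp [h4, outcomes, ho]

/-- Adding `m * (m + 1)` to an address leads to the same entry of the next table. All of table `k`
lies below the address being written, so every operand is already available and nothing needed is
overwritten. -/
theorem entryStage_runs (hG : Grading G) (hI : ∀ x i, I.input.num x i ∈ G B)
    (hg : stageGrade B m ≤ g) (hs : Ready I s) {K q : ℕ} (hq : q < m * (m * (m + 1)))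
    (h4 : s.word 4 0 = q) (h5 : s.word 5 0 = q / (m * (m + 1)))
    (h6 : s.word 6 0 = q % (m * (m + 1)) / (m + 1)) (h7 : s.word 7 0 = q % (m + 1))
    (hnum : ∀ a < q + m * (m + 1), s.num 5 a = I.stages K a) :
    Runs V (G g) entryStage s fun s' =>
      s'.num 5 = Function.update (s.num 5) (q + m * (m + 1))
        (I.stages K (q + m * (m + 1))) := by
  have ho := hs.outcomes
  have hm : 0 < m := Nat.pos_of_ne_zero fun h => by simp [h] at hq
  have hN : 0 < m * (m + 1) := by positivity
  set k := q / (m * (m + 1)) with hk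
  set i := q % (m * (m + 1)) / (m + 1) with hi
  set j := q % (m + 1) with hj
  have hkm : k < m := Nat.div_lt_of_lt_mul (by rwa [mul_comm])
  have him : i < m := Nat.div_lt_of_lt_mul ((Nat.mod_lt q hN).trans_eq (mul_comm _ _))
  have hjm : j < m + 1 := Nat.mod_lt _ (Nat.succ_pos m)
  have hkq : k * (m * (m + 1)) ≤ q := Nat.div_mul_le_self _ _
  have hread : ∀ i' < m, ∀ j' < m + 1,
      s.num 5 (k * (m * (m + 1)) + (i' * (m + 1) + j')) = gauss (I.table K) k i' j' := by
    intro i' hi' j' hj'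
    have := Setting.entry_lt hi' hj'
    rw [hnum _ (by omega), I.stages_address K k hi' hj']
  have hcur : s.num 5 q = gauss (I.table K) k i j := hnum q (by omega)
  have hnext : I.stages K (q + m * (m + 1)) = gaussStep k (gauss (I.table K) k) i j := by
    have h1 : (q + m * (m + 1)) / (m * (m + 1)) = k + 1 := Nat.add_div_right _ hN
    have h2 : (q + m * (m + 1)) % (m * (m + 1)) = q % (m * (m + 1)) := Nat.add_mod_right _ _
    have h3 : (q + m * (m + 1)) % (m + 1) = j := Nat.add_mul_mod_self_right _ _ _
    rw [Setting.stages, h1, h2, h3, gauss]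
  have hmem := hG.gauss_mem (fun i j => I.equation_mem hG hI _ i j) (X := I.table K) k
  have hsucc : stageGrade B (k + 1) ≤ g := (stageGrade_mono B hkm).trans hg
  rw [stageGrade] at hsucc
  have hy := hG.op .div (hmem k j) (hmem k k)
  have hz := hG.op .mul (hmem i k) hy
  have hx := hG.op .sub (hmem i j) hz
  have e1 := hread k hkm j hjm
  have e2 := hread k hkm k (by omega)
  have e3 := hread i him k (by omega)
  refine .seq (.op ?_ (.ite (fun h => .copy ?_ ?_) fun h => .seq (.op ?_ (.op ?_ ?_))))
  · simpa [NRef.get, h5, h7, ho, e1, e2] using hG.mono (by omega) hy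
  · simpa [NRef.get, h5, h7, ho, e1, e2] using hG.mono (by omega) hy
  · have hik : i = k := by simpa [Test.Holds, h5, h6] using h
    rw [hnext, gaussStep, if_pos hik, State.putN_num_self,
      State.putN_num_of_ne _ _ _ (by decide : 5 ≠ 7)]
    simp [NRef.get, NOp.apply, h4, h5, h7, ho, e1, e2]
  · simpa [NRef.get, NOp.apply, h5, h6, h7, ho, e1, e2, e3] using hG.mono (by omega) hz
  · simpa [NRef.get, NOp.apply, h4, h5, h6, h7, ho, e1, e2, e3, hcur] using hG.mono (by omega) hx
  · have hik : ¬ i = k := by simpa [Test.Holds, h5, h6] using h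
    rw [hnext, gaussStep, if_neg hik, State.putN_num_self,
      State.putN_num_of_ne _ _ _ (by decide : 5 ≠ 8),
      State.putN_num_of_ne _ _ _ (by decide : 5 ≠ 7)]
    simp [NRef.get, NOp.apply, h4, h5, h6, h7, ho, e1, e2, e3, hcur]

theorem eliminate_runs (hG : Grading G) (hI : ∀ x i, I.input.num x i ∈ G B)
    (hg : stageGrade B m ≤ g) (hV : Room ℓ n m V) (hs : Ready I s) {K : ℕ}
    (h : ∀ a < m * (m + 1), s.num 5 a = I.table K (a / (m + 1)) (a % (m + 1))) :
    Runs V (G g) eliminate s fun s' =>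
      ∀ a < m * (m * (m + 1)) + m * (m + 1), s'.num 5 a = I.stages K a := by
  refine Runs.count (fun q s' => ∀ a < q + m * (m + 1), s'.num 5 a = I.stages K a)
    hV.table (by decide) ?_ ?_ ?_
  · intro s' hf
    have hs' : Ready I s' := hs.frame hf (by decide) (by decide)
    simp [hs'.outcomes]
  · intro a ha
    rw [zero_add] at ha
    rw [State.putW_num, h a ha, Setting.stages, Nat.div_eq_of_lt ha, Nat.mod_eq_of_lt ha, gauss]
  · intro q hq s' hf h4 ih
    have hs' : Ready I s' := hs.frame hf (by decide) (by decide)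
    refine .seq ((locateStage_runs hV hs' hq h4).conseq fun s₁ hf₁ ⟨h5, h6, h7⟩ => ?_)
    have hs₁ : Ready I s₁ := hs'.frame hf₁ (by decide) (by decide)
    have h4₁ : s₁.word 4 0 = q := by rw [hf₁.word 4 (by decide), h4]
    have hn₁ : s₁.num 5 = s'.num 5 := hf₁.num 5 (by decide)
    refine (entryStage_runs hG hI hg hs₁ hq h4₁ h5 h6 h7 (fun a ha => by
      rw [hn₁, ih a ha])).conseq fun s₂ _ h a haq => ?_
    rw [State.putW_num, h, hn₁]
    rcases eq_or_ne a (q + m * (m + 1)) with rfl | hne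
    · rw [Function.update_self]
    · rw [Function.update_of_ne hne, ih a (by omega)]

theorem extract_runs (hG : Grading G) (hI : ∀ x i, I.input.num x i ∈ G B)
    (hg : stageGrade B m ≤ g) (hV : Room ℓ n m V) (hs : Ready I s) {K : ℕ}
    (h : ∀ a < m * (m * (m + 1)) + m * (m + 1), s.num 5 a = I.stages K a) :
    Runs V (G g) extract s fun s' => ∀ j < m, s'.num 6 j = I.contract K j := by
  have h0 : (0 : ℝ) ∈ G g :=
    hG.mono ((le_add_self.trans (stageGrade_mono B (Nat.zero_le m))).trans hg) hG.zero
  refine .seq (.const (by simpa using h0) ?_)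
  set s₀ := s.putN (cell 7) ((0 : ℚ) : ℝ) with hs₀
  have hr₀ : Ready I s₀ := hs.frame (Frame.putN [] s (cell 7) _) (by simp) (by decide)
  refine Runs.count (fun q s' => s'.num 7 0 = 0 ∧ s'.num 5 = s.num 5 ∧
    ∀ j < q, s'.num 6 j = I.contract K j) ((Nat.le_succ m).trans hV.succ_m) (by decide) ?_
    (by refine ⟨by simp [hs₀], ?_, by simp⟩
        exact State.putN_num_of_ne s (cell 7) ((0 : ℚ) : ℝ) (by decide : (5 : ℕ) ≠ 7)) ?_ |>.conseq fun _ _ h => h.2.2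
  · intro s' hf
    exact (hr₀.frame hf (by decide) (by decide)).outcomes
  · intro q hq s' hf h4 ⟨h7, h5, ih⟩
    have hs' : Ready I s' := hr₀.frame hf (by decide) (by decide)
    have hval : s'.num 5 (m * (m * (m + 1)) + (q * (m + 1) + m)) = gauss (I.table K) m q m := by
      have := Setting.entry_lt hq (Nat.lt_succ_self m)
      rw [h5, h _ (by omega), I.stages_address K m hq (Nat.lt_succ_self m)]
    have hmem := hG.mono hg (hG.gauss_mem (fun i j => I.equation_mem hG hI _ i j)
      (X := I.table K) m q m)
    refine .seq (.copy ?_ (.ite (fun ht => .const (by simpa using h0) ?_) fun ht => .skip ?_))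
    · simpa [NRef.get, h4, hs'.outcomes, hval] using hmem
    all_goals
      simp [Test.Holds, NRef.get, h4, hs'.outcomes, hval, h7] at ht
      refine ⟨by simp [h7], ?_, fun j hj => ?_⟩
      · simp [State.putN_num_of_ne, h5]
      rcases Nat.lt_succ_iff_lt_or_eq.1 hj with hj | rfl
      · simp [h4, hj.ne, ih j hj]
      · simp [NRef.get, h4, hs'.outcomes, hval, Setting.contract, ht, le_of_lt]

end Prog

/-! ### Evaluation of a contract -/

namespace Setting

variable {ℓ n m : ℕ} (I : Setting ℓ n m)

/-- The expected payment in terms of the memory contents. -/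
noncomputable def rawPayment (p : ℕ → ℝ) (θ a : ℕ) : ℝ :=
  ∑ j ∈ Finset.range m, I.input.num 0 (θ * (n * m) + (a * m + j)) * p j

/-- The expected reward in terms of the memory contents. -/
noncomputable def rawReward (θ a : ℕ) : ℝ := I.rawPayment (I.input.num 3) θ a

/-- The utility of the agent in terms of the memory contents. -/
noncomputable def rawAgent (p : ℕ → ℝ) (θ a : ℕ) : ℝ :=
  I.rawPayment p θ a - I.input.num 1 (θ * n + a)

/-- The utility of the principal in terms of the memory contents. -/
noncomputable def rawPrincipal (p : ℕ → ℝ) (θ a : ℕ) : ℝ :=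
  I.rawReward θ a - I.rawPayment p θ a

theorem rawPayment_eq (p : ℕ → ℝ) (θ : Fin ℓ) (a : Fin n) :
    I.rawPayment p θ a = I.payment (fun ω => p ω) θ a := by
  rw [rawPayment, Finset.sum_range, payment]
  exact Finset.sum_congr rfl fun ω _ => by rw [input_F]

theorem rawReward_eq (θ : Fin ℓ) (a : Fin n) : I.rawReward θ a = I.reward θ a := by
  rw [rawReward, rawPayment_eq, payment, reward]
  exact Finset.sum_congr rfl fun ω _ => by rw [input_r]

theorem rawAgent_eq (p : ℕ → ℝ) (θ : Fin ℓ) (a : Fin n) :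
    I.rawAgent p θ a = I.agentUtility (fun ω => p ω) θ a := by
  rw [rawAgent, rawPayment_eq, input_c, agentUtility]

theorem rawPrincipal_eq (p : ℕ → ℝ) (θ : Fin ℓ) (a : Fin n) :
    I.rawPrincipal p θ a = I.principalUtility (fun ω => p ω) θ a := by
  rw [rawPrincipal, rawPayment_eq, rawReward_eq, principalUtility]

/-- The action `a` is best for the agent among the first `k` actions, ties being broken in favour of
the principal. -/
def IsBest (p : ℕ → ℝ) (θ k a : ℕ) : Prop :=
  a < k ∧ ∀ a' < k, I.rawAgent p θ a' < I.rawAgent p θ a ∨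
    I.rawAgent p θ a' = I.rawAgent p θ a ∧ I.rawPrincipal p θ a' ≤ I.rawPrincipal p θ a

variable {I}

theorem IsBest.implements {p : ℕ → ℝ} {θ : Fin ℓ} {a : Fin n} (h : I.IsBest p θ n a) :
    I.Implements (fun ω => p ω) θ a := by
  have h' : ∀ a' : Fin n, _ := fun a' => h.2 a' a'.2
  simp only [rawAgent_eq, rawPrincipal_eq] at h'
  refine ⟨fun a' => ?_, fun a' ha' => ?_⟩
  · rcases h' a' with h | h
    exacts [h.le, h.1.le]
  · rcases h' a' with h | h
    exacts [absurd (ha' a) (not_le.2 h), h.2]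

theorem IsBest.succ_of_better {p : ℕ → ℝ} {θ k a : ℕ} (h : I.IsBest p θ k a)
    (hk : I.rawAgent p θ a < I.rawAgent p θ k ∨
      I.rawAgent p θ a ≤ I.rawAgent p θ k ∧ I.rawPrincipal p θ a < I.rawPrincipal p θ k) :
    I.IsBest p θ (k + 1) k := by
  refine ⟨Nat.lt_succ_self k, fun a' ha' => ?_⟩
  rcases Nat.lt_succ_iff_lt_or_eq.1 ha' with ha' | rfl
  · rcases hk with hk | ⟨hk, hk'⟩ <;> rcases h.2 a' ha' with h | ⟨h, h'⟩
    · exact .inl (h.trans hk)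
    · exact .inl (h.trans_lt hk)
    · exact .inl (h.trans_le hk)
    · exact (h.trans_le hk).lt_or_eq.imp id fun e => ⟨e, h'.trans hk'.le⟩
  · exact .inr ⟨rfl, le_rfl⟩

theorem IsBest.succ_of_not_better {p : ℕ → ℝ} {θ k a : ℕ} (h : I.IsBest p θ k a)
    (hk : ¬ (I.rawAgent p θ a < I.rawAgent p θ k ∨
      I.rawAgent p θ a ≤ I.rawAgent p θ k ∧ I.rawPrincipal p θ a < I.rawPrincipal p θ k)) :
    I.IsBest p θ (k + 1) a := by
  refine ⟨h.1.trans (Nat.lt_succ_self k), fun a' ha' => ?_⟩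
  rcases Nat.lt_succ_iff_lt_or_eq.1 ha' with ha' | rfl
  · exact h.2 a' ha'
  · push Not at hk
    exact hk.1.lt_or_eq.imp id fun e => ⟨e, hk.2 e.ge⟩

/-- A bound on the sizes of the payments and rewards, for a contract of size `g`. -/
def payGrade (m B g : ℕ) : ℕ := 1 + m * (B + g + 2)

theorem rawPayment_mem {G : ℕ → Set ℝ} (hG : Grading G) {B g : ℕ}
    (hI : ∀ x i, I.input.num x i ∈ G B) {p : ℕ → ℝ} (hp : ∀ j < m, p j ∈ G g) (θ a : ℕ) {k : ℕ}
    (hk : k ≤ m) :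
    ∑ j ∈ Finset.range k, I.input.num 0 (θ * (n * m) + (a * m + j)) * p j ∈
      G (payGrade m B g) :=
  hG.mono (Nat.add_le_add_left (Nat.mul_le_mul_right _ hk) _)
    (hG.sum_mem (fun _ _ => hI _ _) fun j hj => hp j (by omega))

theorem payGrade_mono {m B g g' : ℕ} (h : g ≤ g') : payGrade m B g ≤ payGrade m B g' := by
  unfold payGrade
  gcongr

/-- A bound on the sizes of all numbers that occur in the evaluation of a contract. -/
def valueGrade (ℓ m B g : ℕ) : ℕ := 1 + ℓ * (B + (2 * payGrade m B g + 1) + 2)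

theorem le_valueGrade {ℓ : ℕ} (hℓ : 0 < ℓ) (m B g : ℕ) :
    B + 2 * payGrade m B g + 4 ≤ valueGrade ℓ m B g := by
  have := Nat.le_mul_of_pos_left (B + (2 * payGrade m B g + 1) + 2) hℓ
  rw [valueGrade]
  omega

theorem le_payGrade {m : ℕ} (hm : 0 < m) (B g : ℕ) : B + g + 3 ≤ payGrade m B g := by
  have := Nat.le_mul_of_pos_left (B + g + 2) hm
  rw [payGrade]
  omega

end Setting

namespace Prog

open WExp

variable {ℓ n m : ℕ} {I : Setting ℓ n m} {G : ℕ → Set ℝ} {V B g gp : ℕ} {s : State}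

theorem accumulate_runs (hG : Grading G) (hI : ∀ x i, I.input.num x i ∈ G B) {p : ℕ → ℝ}
    (hp : ∀ j < m, p j ∈ G gp) (hB : B ≤ gp) (hg : Setting.valueGrade ℓ m B gp ≤ g)
    (hV : Room ℓ n m V) (hs : Ready I s) (h6 : ∀ j < m, s.num 6 j = p j) {θ a : ℕ}
    (h4 : s.word 4 0 = θ) (h5 : s.word 5 0 = a) :
    Runs V (G g) accumulate s fun s' =>
      s'.num 9 0 = I.rawPayment p θ a ∧ s'.num 10 0 = I.rawReward θ a := by
  have hvg := Setting.le_valueGrade hV.ℓ_pos m B gp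
  have hpg := Setting.le_payGrade hV.m_pos B gp
  have h0 : (0 : ℝ) ∈ G g := hG.mono (by omega) hG.zero
  refine .seq (.const (by simpa using h0) (.seq (.const (by simpa using h0) ?_)))
  set s₀ := (s.putN (cell 9) ((0 : ℚ) : ℝ)).putN (cell 10) ((0 : ℚ) : ℝ) with hs₀
  have hf₀ : Frame [] [9, 10] s s₀ :=
    ((Frame.putN [] s (cell 9) _).mono (by simp) (by simp)).trans
      ((Frame.putN [] _ (cell 10) _).mono (by simp) (by simp))
  have hr₀ : Ready I s₀ := hs.frame hf₀ (by simp) (by decide)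
  refine Runs.count (b := m) (fun k s' =>
    s'.num 9 0 = ∑ j ∈ Finset.range k, I.input.num 0 (θ * (n * m) + (a * m + j)) * p j ∧
    s'.num 10 0 = ∑ j ∈ Finset.range k, I.input.num 0 (θ * (n * m) + (a * m + j)) *
      I.input.num 3 j) ((Nat.le_succ m).trans hV.succ_m) (by decide) ?_ (by simp [hs₀]) ?_
  · intro s' hf
    exact (hr₀.frame hf (by decide) (by decide)).outcomes
  · intro k hk s' hf hk6 ⟨h9, h10⟩
    have hs' : Ready I s' := hr₀.frame hf (by decide) (by decide)
    have ho := hs'.outcomes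
    have ha := hs'.actions
    have e4 : s'.word 4 0 = θ := by rw [hf.word 4 (by decide), hf₀.word 4 (by decide), h4]
    have e5 : s'.word 5 0 = a := by rw [hf.word 5 (by decide), hf₀.word 5 (by decide), h5]
    have e6 : s'.num 6 k = p k := by
      rw [hf.num 6 (by decide), hf₀.num 6 (by decide), h6 k hk]
    have hd : ∀ x < 4, ∀ i, s'.num x i = I.input.num x i := fun x hx i =>
      congrFun (hs'.num x hx) i
    have hz := hG.op .mul (hI 0 (θ * (n * m) + (a * m + k))) (hp k hk)
    have hz' := hG.op .mul (hI 0 (θ * (n * m) + (a * m + k))) (hI 3 k)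
    have hsum := Setting.rawPayment_mem hG hI hp θ a (show k + 1 ≤ m from hk)
    have hsum' := Setting.rawPayment_mem hG hI (fun j _ => hI 3 j) θ a (show k + 1 ≤ m from hk)
    have hpm := Setting.payGrade_mono (m := m) (B := B) hB
    rw [Finset.sum_range_succ] at hsum hsum'
    refine .seq (.op ?_ (.seq (.op ?_ (.seq (.op ?_ (.op ?_ ?_))))))
    · simpa [NRef.get, e4, e5, hk6, ho, ha, e6, hd] using hG.mono (by omega) hz
    · simpa [NRef.get, NOp.apply, e4, e5, hk6, ho, ha, e6, hd, h9] using hG.mono (by omega) hsum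
    · simpa [NRef.get, NOp.apply, e4, e5, hk6, ho, ha, e6, hd] using hG.mono (by omega) hz'
    · simpa [NRef.get, NOp.apply, e4, e5, hk6, ho, ha, e6, hd, h10] using
        hG.mono (by omega) hsum'
    · simp [NRef.get, NOp.apply, e4, e5, hk6, ho, ha, e6, hd, h9, h10, Finset.sum_range_succ]

theorem utilities_runs (hG : Grading G) (hI : ∀ x i, I.input.num x i ∈ G B) {p : ℕ → ℝ}
    (hp : ∀ j < m, p j ∈ G gp) (hB : B ≤ gp) (hg : Setting.valueGrade ℓ m B gp ≤ g)
    (hV : Room ℓ n m V) (hs : Ready I s) (h6 : ∀ j < m, s.num 6 j = p j) {θ a : ℕ}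
    (h4 : s.word 4 0 = θ) (h5 : s.word 5 0 = a) :
    Runs V (G g) utilities s fun s' =>
      s'.num 11 0 = I.rawAgent p θ a ∧ s'.num 12 0 = I.rawPrincipal p θ a := by
  refine .seq ((accumulate_runs hG hI hp hB hg hV hs h6 h4 h5).conseq fun s₁ hf ⟨h9, h10⟩ => ?_)
  have hs₁ : Ready I s₁ := hs.frame hf (by decide) (by decide)
  have e4 : s₁.word 4 0 = θ := by rw [hf.word 4 (by decide), h4]
  have e5 : s₁.word 5 0 = a := by rw [hf.word 5 (by decide), h5]
  have hvg := Setting.le_valueGrade hV.ℓ_pos m B gp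
  have hP := Setting.rawPayment_mem hG hI hp θ a le_rfl
  have hR := hG.mono (Setting.payGrade_mono hB)
    (Setting.rawPayment_mem hG hI (fun j _ => hI 3 j) θ a le_rfl)
  have hd : ∀ i, s₁.num 1 i = I.input.num 1 i := fun i => congrFun (hs₁.num 1 (by decide)) i
  refine .seq (.op ?_ (.op ?_ ?_))
  · simpa [NRef.get, NOp.apply, e4, e5, h9, hs₁.actions, hd, Setting.rawPayment] using
      hG.mono (by omega) (hG.op .sub hP (hI 1 (θ * n + a)))
  · simpa [NRef.get, NOp.apply, h9, h10, Setting.rawPayment, Setting.rawReward] using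
      hG.mono (by omega) (hG.op .sub hR hP)
  · simp [NRef.get, NOp.apply, e4, e5, h9, h10, hs₁.actions, hd, Setting.rawAgent,
      Setting.rawPrincipal]

theorem rawAgent_mem (hG : Grading G) (hI : ∀ x i, I.input.num x i ∈ G B) {p : ℕ → ℝ}
    (hp : ∀ j < m, p j ∈ G gp) (hm : 0 < m) (θ a : ℕ) :
    I.rawAgent p θ a ∈ G (2 * Setting.payGrade m B gp + 1) := by
  have hpg := Setting.le_payGrade hm B gp
  exact hG.mono (by omega) (hG.op .sub (Setting.rawPayment_mem hG hI hp θ a le_rfl) (hI _ _))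

theorem rawPrincipal_mem (hG : Grading G) (hI : ∀ x i, I.input.num x i ∈ G B) {p : ℕ → ℝ}
    (hp : ∀ j < m, p j ∈ G gp) (hB : B ≤ gp) (θ a : ℕ) :
    I.rawPrincipal p θ a ∈ G (2 * Setting.payGrade m B gp + 1) := by
  have hpm := Setting.payGrade_mono (m := m) (B := B) hB
  exact hG.mono (by omega) (hG.op .sub
    (Setting.rawPayment_mem hG hI (fun j _ => hI 3 j) θ a le_rfl)
    (Setting.rawPayment_mem hG hI hp θ a le_rfl))

theorem isBetter_holds : isBetter.Holds s ↔ s.word 5 0 = 0 ∨ s.num 13 0 < s.num 11 0 ∨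
    s.num 13 0 ≤ s.num 11 0 ∧ s.num 14 0 < s.num 12 0 := by
  simp only [isBetter, Test.Holds, eval_var, eval_lit, cell_get, ← not_lt]
  tauto

theorem bestAction_runs (hG : Grading G) (hI : ∀ x i, I.input.num x i ∈ G B) {p : ℕ → ℝ}
    (hp : ∀ j < m, p j ∈ G gp) (hB : B ≤ gp) (hg : Setting.valueGrade ℓ m B gp ≤ g)
    (hV : Room ℓ n m V) (hs : Ready I s) (h6 : ∀ j < m, s.num 6 j = p j) {θ : ℕ}
    (h4 : s.word 4 0 = θ) :
    Runs V (G g) bestAction s fun s' =>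
      ∃ a, I.IsBest p θ n a ∧ s'.num 14 0 = I.rawPrincipal p θ a := by
  have hvg := Setting.le_valueGrade hV.ℓ_pos m B gp
  -- For `k = 0` nothing is claimed: the cells `13` and `14` may still hold values of the previous
  -- type, which the first action overwrites unconditionally.
  refine (Runs.count (b := n) (fun k s' => 0 < k → ∃ a, I.IsBest p θ k a ∧
    s'.num 13 0 = I.rawAgent p θ a ∧ s'.num 14 0 = I.rawPrincipal p θ a) hV.le_n (by decide)
    (fun s' hf => (hs.frame hf (by decide) (by decide)).actions) (by simp) ?_).conseq
    fun s' _ h => (h hV.n_pos).imp fun a h => ⟨h.1, h.2.2⟩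
  intro k hk s' hf h5 ih
  have hs' : Ready I s' := hs.frame hf (by decide) (by decide)
  have h6' : ∀ j < m, s'.num 6 j = p j := fun j hj => by rw [hf.num 6 (by decide), h6 j hj]
  have h4' : s'.word 4 0 = θ := by rw [hf.word 4 (by decide), h4]
  refine .seq ((utilities_runs hG hI hp hB hg hV hs' h6' h4' h5).conseq
    fun s₁ hf₁ ⟨h11, h12⟩ => ?_)
  have e5 : s₁.word 5 0 = k := by rw [hf₁.word 5 (by decide), h5]
  have ih' : 0 < k → ∃ a, I.IsBest p θ k a ∧ s₁.num 13 0 = I.rawAgent p θ a ∧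
      s₁.num 14 0 = I.rawPrincipal p θ a := fun hk0 => by
    rw [hf₁.num 13 (by decide), hf₁.num 14 (by decide)]
    exact ih hk0
  refine .ite (fun ht => .seq (.copy ?_ (.copy ?_ ?_))) fun ht => .skip ?_
  · simpa [h11] using hG.mono (by omega) (rawAgent_mem hG hI hp hV.m_pos θ k)
  · simpa [h12] using hG.mono (by omega) (rawPrincipal_mem hG hI hp hB θ k)
  · refine fun _ => ⟨k, ?_, by simp [h11, h12]⟩
    rcases Nat.eq_zero_or_pos k with rfl | hk0
    · exact ⟨Nat.one_pos, fun a' ha' => .inr (by simp [Nat.lt_one_iff.1 ha'])⟩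
    · obtain ⟨a, hbest, h13, h14⟩ := ih' hk0
      rw [isBetter_holds, e5, h11, h12, h13, h14] at ht
      exact hbest.succ_of_better (ht.resolve_left hk0.ne')
  · intro _
    have hk0 : k ≠ 0 := fun h => ht (isBetter_holds.2 (.inl (e5.trans h)))
    obtain ⟨a, hbest, h13, h14⟩ := ih' (Nat.pos_of_ne_zero hk0)
    rw [isBetter_holds, e5, h11, h12, h13, h14] at ht
    exact ⟨a, hbest.succ_of_not_better fun h => ht (.inr h), h13, h14⟩

theorem evaluate_runs (hG : Grading G) (hI : ∀ x i, I.input.num x i ∈ G B) {p : ℕ → ℝ}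
    (hp : ∀ j < m, p j ∈ G gp) (hB : B ≤ gp) (hg : Setting.valueGrade ℓ m B gp ≤ g)
    (hV : Room ℓ n m V) (hs : Ready I s) (h6 : ∀ j < m, s.num 6 j = p j) :
    Runs V (G g) evaluate s fun s' =>
      s'.num 15 0 ∈ G g ∧ I.HasValue (fun ω => p ω) (s'.num 15 0) := by
  have hvg := Setting.le_valueGrade hV.ℓ_pos m B gp
  have h0 : (0 : ℝ) ∈ G g := hG.mono (by omega) hG.zero
  refine .seq (.const (by simpa using h0) ?_)
  set s₀ := s.putN (cell 15) ((0 : ℚ) : ℝ) with hs₀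
  have hf₀ : Frame [] [15] s s₀ := Frame.putN [] s (cell 15) _
  have hr₀ : Ready I s₀ := hs.frame hf₀ (by simp) (by decide)
  -- The function `f` records the actions taken by the first `k` types; its other values are
  -- arbitrary.
  refine (Runs.count (b := ℓ) (fun k s' => ∃ f : ℕ → ℕ, (∀ θ, I.IsBest p θ n (f θ) ∨ k ≤ θ) ∧
    s'.num 15 0 = ∑ θ ∈ Finset.range k, I.input.num 2 θ * I.rawPrincipal p θ (f θ)) hV.le_ℓ
    (by decide) (fun s' hf => (hr₀.frame hf (by decide) (by decide)).types)
    ⟨id, by simp, by simp [hs₀]⟩ ?_).conseq fun s' _ ⟨f, hf, h15⟩ => ?_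
  · intro k hk s' hf h4 ⟨f, hbest, h15⟩
    have hs' : Ready I s' := hr₀.frame hf (by decide) (by decide)
    have h6' : ∀ j < m, s'.num 6 j = p j := fun j hj => by
      rw [hf.num 6 (by decide), hf₀.num 6 (by decide), h6 j hj]
    refine .seq ((bestAction_runs hG hI hp hB hg hV hs' h6' h4).conseq
      fun s₁ hf₁ ⟨a, ha, h14⟩ => ?_)
    have hs₁ : Ready I s₁ := hs'.frame hf₁ (by decide) (by decide)
    have e4 : s₁.word 4 0 = k := by rw [hf₁.word 4 (by decide), h4]
    have e15 : s₁.num 15 0 = _ := (congrFun (hf₁.num 15 (by decide)) 0).trans h15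
    have hd : ∀ i, s₁.num 2 i = I.input.num 2 i := fun i => congrFun (hs₁.num 2 (by decide)) i
    have hz := hG.op .mul (hI 2 k) (rawPrincipal_mem hG hI hp hB k a)
    have hsum := hG.sum_mem (k := k + 1) (fun i _ => hI 2 i) fun i _ =>
      rawPrincipal_mem hG hI hp hB i (Function.update f k a i)
    have hle : 1 + (k + 1) * (B + (2 * Setting.payGrade m B gp + 1) + 2) ≤ g :=
      le_trans (Nat.add_le_add_left (Nat.mul_le_mul_right _ hk) _) hg
    have hupd : ∑ θ ∈ Finset.range k, I.input.num 2 θ *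
        I.rawPrincipal p θ (Function.update f k a θ) =
        ∑ θ ∈ Finset.range k, I.input.num 2 θ * I.rawPrincipal p θ (f θ) :=
      Finset.sum_congr rfl fun θ hθ => by
        rw [Function.update_of_ne (Finset.mem_range.1 hθ).ne]
    rw [Finset.sum_range_succ, hupd, Function.update_self] at hsum
    refine .seq (.op ?_ (.op ?_ ⟨Function.update f k a, fun θ => ?_, ?_⟩))
    · simpa [NRef.get, e4, h14, hd] using hG.mono (by omega) hz
    · simpa [NRef.get, NOp.apply, e4, h14, hd, e15] using hG.mono hle hsum
    · rcases eq_or_ne θ k with rfl | hne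
      · rw [Function.update_self]
        exact .inl ha
      · rw [Function.update_of_ne hne]
        exact (hbest θ).imp id fun h => by omega
    · rw [Finset.sum_range_succ, hupd, Function.update_self]
      simp [NRef.get, NOp.apply, e4, h14, hd, e15]
  · have hbest : ∀ θ : Fin ℓ, I.IsBest p θ n (f θ) := fun θ =>
      (hf θ).resolve_right (by omega)
    refine ⟨?_, fun θ => ⟨f θ, (hbest θ).1⟩, fun θ => (hbest θ).implements, ?_⟩
    · rw [h15]
      exact hG.mono hg (hG.sum_mem (fun i _ => hI 2 i) fun i _ =>
        rawPrincipal_mem hG hI hp hB i (f i))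
    · rw [h15, Finset.sum_range, Setting.overallUtility]
      exact Finset.sum_congr rfl fun θ _ => by
        rw [Setting.input_μ, ← I.rawPrincipal_eq p θ ⟨f θ, (hbest θ).1⟩]

end Prog

/-! ### The search for the best contract -/

/-- The best contract so far is in memory, with a lower bound on its value. -/
def HoldsContract {ℓ n m : ℕ} (I : Setting ℓ n m) (s : State) : Prop :=
  (∀ ω, 0 ≤ output m s ω) ∧ ∃ u, I.HasValue (output m s) u ∧ s.num 16 0 ≤ u

theorem HoldsContract.congr {ℓ n m : ℕ} {I : Setting ℓ n m} {s s' : State}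
    (h : HoldsContract I s) (h4 : s'.num 4 = s.num 4) (h16 : s'.num 16 = s.num 16) :
    HoldsContract I s' := by
  have : output m s' = output m s := by
    funext ω
    rw [output, h4, output]
  rwa [HoldsContract, this, h16]

namespace Prog

open WExp

variable {ℓ n m : ℕ} {I : Setting ℓ n m} {G : ℕ → Set ℝ} {V B g : ℕ} {s : State}

theorem keep_runs {A : Set ℝ} {p : ℕ → ℝ} (hp : ∀ j < m, p j ∈ A) (hp0 : ∀ j < m, 0 ≤ p j)
    (hV : Room ℓ n m V) (hs : Ready I s) (h6 : ∀ j < m, s.num 6 j = p j)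
    (h15 : s.num 15 0 ∈ A) (hval : I.HasValue (fun ω => p ω) (s.num 15 0))
    (hc : HoldsContract I s) :
    Runs V A keep s fun s' => HoldsContract I s' ∧ s.num 16 0 ≤ s'.num 16 0 ∧
      s.num 15 0 ≤ s'.num 16 0 := by
  refine .ite (fun ht => .seq (.copy h15 ?_)) fun ht => .skip ⟨hc, le_rfl, not_lt.1 ht⟩
  simp only [Test.Holds, cell_get] at ht
  set s₀ := s.putN (cell 16) ((cell 15).get s) with hs₀
  have hf₀ : Frame [] [16] s s₀ := Frame.putN [] s (cell 16) _
  have hr₀ : Ready I s₀ := hs.frame hf₀ (by simp) (by decide)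
  refine (Runs.count (b := m) (fun k s' => s'.num 16 0 = s.num 15 0 ∧
    ∀ j < k, s'.num 4 j = p j) ((Nat.le_succ m).trans hV.succ_m) (by decide)
    (fun s' hf => (hr₀.frame hf (by decide) (by decide)).outcomes)
    (by simp [hs₀]) ?_).conseq fun s' _ ⟨h16, h4⟩ => ?_
  · intro k hk s' hf h4 ⟨h16, ih⟩
    have e6 : s'.num 6 k = p k := by
      rw [hf.num 6 (by decide), hf₀.num 6 (by decide), h6 k hk]
    refine .copy (by simpa [NRef.get, h4, e6] using hp k hk) ⟨by simp [h16], fun j hj => ?_⟩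
    rcases Nat.lt_succ_iff_lt_or_eq.1 hj with hj | rfl
    · simp [h4, hj.ne, ih j hj]
    · simp [NRef.get, h4, e6]
  · have hout : output m s' = fun ω : Fin m => p ω := funext fun ω => h4 ω ω.2
    refine ⟨⟨fun ω => ?_, _, hout ▸ hval, h16.le⟩, h16 ▸ ht.le, h16.ge⟩
    rw [hout]
    exact hp0 ω ω.2

/-- A bound on the sizes of all numbers that occur in a run of the program. -/
def runGrade (ℓ m B : ℕ) : ℕ := Setting.valueGrade ℓ m B (stageGrade B m)

theorem stageGrade_le_runGrade (hℓ : 0 < ℓ) (hm : 0 < m) (B : ℕ) :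
    stageGrade B m ≤ runGrade ℓ m B := by
  have h1 := Setting.le_valueGrade hℓ m B (stageGrade B m)
  have h2 := Setting.le_payGrade hm B (stageGrade B m)
  rw [runGrade]
  omega

theorem search_runs (hG : Grading G) (hI : ∀ x i, I.input.num x i ∈ G B) (hV : Room ℓ n m V)
    (hs : Ready I s) (hc : HoldsContract I s) :
    Runs V (G (runGrade ℓ m B)) search s fun s' => HoldsContract I s' ∧
      ∀ K < (ℓ * (n * n) + 1) ^ m, ∃ w ≤ s'.num 16 0, I.HasValue (fun ω => I.contract K ω) w := by
  have hg := stageGrade_le_runGrade hV.ℓ_pos hV.m_pos B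
  have hB1 : 2 * B + 1 ≤ stageGrade B m := stageGrade_mono B (Nat.zero_le m)
  refine .seq ((powers_runs hV hs).conseq fun s₀ hf₀ hp₀ => ?_)
  have hs₀ : Ready I s₀ := hs.frame hf₀ (by decide) (by decide)
  have hc₀ := hc.congr (hf₀.num 4 (by decide)) (hf₀.num 16 (by decide))
  refine Runs.count (fun k s' => HoldsContract I s' ∧
    ∀ K < k, ∃ w ≤ s'.num 16 0, I.HasValue (fun ω => I.contract K ω) w) hV.pow (by decide)
    (fun s' hf => ?_) ⟨hc₀.congr rfl rfl, by simp⟩ ?_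
  · have hs' : Ready I s' := hs₀.frame hf (by decide) (by decide)
    have hp' : HasPowers ℓ n m s' := hp₀.frame hf (by decide) (by decide)
    rw [eval_read, hs'.outcomes, hp'.pow m le_rfl]
  · intro K hK s' hf h3 ⟨hc', ih⟩
    have hs' : Ready I s' := hs₀.frame hf (by decide) (by decide)
    have hp' : HasPowers ℓ n m s' := hp₀.frame hf (by decide) (by decide)
    refine .seq ((build_runs hG hI (hB1.trans hg) hV hs' hp' h3).conseq fun s₁ hf₁ h₁ => ?_)
    have hs₁ : Ready I s₁ := hs'.frame hf₁ (by decide) (by decide)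
    refine .seq ((eliminate_runs hG hI hg hV hs₁ h₁).conseq fun s₂ hf₂ h₂ => ?_)
    have hs₂ : Ready I s₂ := hs₁.frame hf₂ (by decide) (by decide)
    refine .seq ((extract_runs hG hI hg hV hs₂ h₂).conseq fun s₃ hf₃ h₃ => ?_)
    have hs₃ : Ready I s₃ := hs₂.frame hf₃ (by decide) (by decide)
    refine .seq ((evaluate_runs hG hI (fun j _ => I.contract_mem hG hI K j) (by omega) le_rfl hV
      hs₃ h₃).conseq fun s₄ hf₄ ⟨h15, hval⟩ => ?_)
    have hs₄ : Ready I s₄ := hs₃.frame hf₄ (by decide) (by decide)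
    have h₄ : ∀ j < m, s₄.num 6 j = I.contract K j := fun j hj => by
      rw [hf₄.num 6 (by decide), h₃ j hj]
    have e16 : s₄.num 16 = s'.num 16 := by
      rw [hf₄.num 16 (by decide), hf₃.num 16 (by decide), hf₂.num 16 (by decide),
        hf₁.num 16 (by decide)]
    have hc₄ : HoldsContract I s₄ := hc'.congr (by
      rw [hf₄.num 4 (by decide), hf₃.num 4 (by decide), hf₂.num 4 (by decide),
        hf₁.num 4 (by decide)]) e16
    refine (keep_runs (fun j _ => hG.mono hg (I.contract_mem hG hI K j))
      (fun j _ => le_max_right _ _) hV hs₄ h₄ h15 hval hc₄).conseq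
      fun s₅ _ ⟨hc₅, h16, h15'⟩ => ⟨hc₅.congr rfl rfl, fun K' hK' => ?_⟩
    rw [State.putW_num]
    rcases Nat.lt_succ_iff_lt_or_eq.1 hK' with hK' | rfl
    · obtain ⟨w, hw, hv⟩ := ih K' hK'
      exact ⟨w, hw.trans (e16 ▸ h16), hv⟩
    · exact ⟨_, h15', hval⟩

/-- Each candidate is among the contracts tried, and cell `16` lies between their values and the
value of the contract kept. -/
theorem isOptimal_of_search (hc : HoldsContract I s)
    (h : ∀ K < (ℓ * (n * n) + 1) ^ m, ∃ w ≤ s.num 16 0, I.HasValue (fun ω => I.contract K ω) w) :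
    I.IsOptimal (output m s) := by
  obtain ⟨h0, u, hu, hle⟩ := hc
  refine I.isOptimal_of_forall_candidates h0 hu fun q hq => ?_
  obtain ⟨K, hK, hKq⟩ := I.exists_contract_eq hq
  obtain ⟨w, hw, hv⟩ := h K hK
  rw [funext hKq] at hv
  exact ⟨w, hw.trans hle, hv⟩

end Prog

/-! ### The initial memory and the case of a single action -/

namespace Setting

variable {ℓ n m : ℕ} (I : Setting ℓ n m)

theorem ready_input : Ready I I.input := ⟨rfl, fun _ _ => rfl⟩

theorem output_input : output m I.input = 0 := by
  funext ω
  simp [output, input]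

theorem payment_zero (θ : Fin ℓ) (a : Fin n) : I.payment 0 θ a = 0 := by
  simp [payment]

/-- Empty memory holds the zero contract and the recorded value `0`. This is a valid lower bound, as
rewards are nonnegative, though not necessarily the exact value. So nothing has to be initialized.
-/
theorem holdsContract_input : HoldsContract I I.input := by
  rw [HoldsContract, output_input]
  obtain ⟨u, a, ha, rfl⟩ := I.exists_hasValue 0
  refine ⟨fun _ => le_rfl, _, ⟨a, ha, rfl⟩, ?_⟩
  have h16 : I.input.num 16 0 = 0 := by simp [input]
  rw [h16]
  refine Finset.sum_nonneg fun θ _ => mul_nonneg (I.μ_nonneg θ) ?_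
  rw [principalUtility, payment_zero, sub_zero]
  exact I.reward_nonneg θ _

/-- With a single action, there is nothing to pay for. -/
theorem isOptimal_zero_of_subsingleton [Subsingleton (Fin n)] : I.IsOptimal 0 := by
  obtain ⟨u, a, ha, -⟩ := I.exists_hasValue 0
  refine ⟨fun _ => le_rfl, a, ha, fun q hq b _ => ?_⟩
  refine Finset.sum_le_sum fun θ _ => mul_le_mul_of_nonneg_left ?_ (I.μ_nonneg θ)
  rw [Subsingleton.elim (b θ) (a θ), principalUtility, principalUtility, payment_zero, sub_zero]
  exact sub_le_self _ (I.payment_nonneg hq θ _)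

theorem bdd_input {V : ℕ} (hV : Room ℓ n m V) : I.input.Bdd V := by
  intro x i
  unfold input
  dsimp only
  split_ifs
  exacts [hV.le_ℓ, hV.le_n, (Nat.le_succ m).trans hV.succ_m, Nat.zero_le _, Nat.zero_le _]

end Setting

/-! ### Polynomial bounds -/

/-- A bound on the words in the memory, in terms of the parameters of the running time. -/
def wordBound (x y : ℕ) : ℕ := (x ^ 3 * y) ^ 3

/-- With `n ≥ 2` the summand `1` in the base is absorbed by a further factor `n`, and `m < 2 ^ m ≤ n
^ m`. Both fail to follow for `n = 1`; when `ℓ = 1` as well, the parameters carry no information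
about `m`. -/
theorem room_wordBound {ℓ n m : ℕ} (hℓ : 0 < ℓ) (hn : 2 ≤ n) (hm : 0 < m) :
    Room ℓ n m (wordBound (n ^ m) (ℓ ^ m)) := by
  have hbase : (ℓ * (n * n) + 1) ^ m ≤ (n ^ m) ^ 3 * ℓ ^ m := by
    have h1 : ℓ * (n * n) + 1 ≤ n ^ 3 * ℓ := by
      have h2 : 1 ≤ ℓ * (n * n) := Nat.mul_pos hℓ (by positivity)
      have h3 : 2 * (ℓ * (n * n)) ≤ n * (ℓ * (n * n)) := Nat.mul_le_mul_right _ hn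
      calc ℓ * (n * n) + 1 ≤ n * (ℓ * (n * n)) := by omega
        _ = n ^ 3 * ℓ := by ring
    calc (ℓ * (n * n) + 1) ^ m ≤ (n ^ 3 * ℓ) ^ m := Nat.pow_le_pow_left h1 m
      _ = (n ^ m) ^ 3 * ℓ ^ m := by rw [mul_pow, ← pow_mul, ← pow_mul, mul_comm 3]
  have hmL : m + 1 ≤ (n ^ m) ^ 3 * ℓ ^ m :=
    calc m + 1 ≤ 2 ^ m := Nat.lt_two_pow_self
      _ ≤ n ^ m := Nat.pow_le_pow_left hn m
      _ ≤ (n ^ m) ^ 3 := Nat.le_self_pow (by norm_num) _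
      _ ≤ (n ^ m) ^ 3 * ℓ ^ m := Nat.le_mul_of_pos_right _ (by positivity)
  refine ⟨hbase.trans (Nat.le_self_pow (by norm_num) _), ?_, hℓ, by omega, hm⟩
  set L := (n ^ m) ^ 3 * ℓ ^ m with hL
  calc m * (m * (m + 1)) ≤ L * (L * L) := by gcongr <;> omega
    _ = wordBound (n ^ m) (ℓ ^ m) := by rw [wordBound, ← hL]; ring

/-- A polynomial bound on the sizes of the numbers. -/
def bitBound (x y B : ℕ) : ℕ := 1 + y * (B + (2 * (1 + x * (B + x ^ 2 * (2 * B + 2) + 2)) + 1) + 2)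

theorem runGrade_le {ℓ n m : ℕ} (hn : 2 ≤ n) (hm : 0 < m) (B : ℕ) :
    Prog.runGrade ℓ m B ≤ bitBound (n ^ m) (ℓ ^ m) B := by
  have h2 : 2 ^ m ≤ n ^ m := Nat.pow_le_pow_left hn m
  have h1 : m ≤ n ^ m := Nat.lt_two_pow_self.le.trans h2
  have h3 : stageGrade B m ≤ (n ^ m) ^ 2 * (2 * B + 2) := by
    refine (Nat.le_succ _).trans ((stageGrade_succ B m).trans_le (Nat.mul_le_mul_right _ ?_))
    calc 4 ^ m = (2 ^ m) ^ 2 := by rw [← pow_mul, mul_comm, pow_mul]; norm_num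
      _ ≤ (n ^ m) ^ 2 := Nat.pow_le_pow_left h2 2
  have h4 : ℓ ≤ ℓ ^ m := Nat.le_self_pow hm.ne' _
  unfold Prog.runGrade Setting.valueGrade Setting.payGrade bitBound
  gcongr

theorem Exec.mono {W : ℕ} {A A' : Set ℝ} {c : Cmd} {s s' : State} {t : ℕ}
    (h : Exec W A c s s' t) (hA : A ⊆ A') :
    Exec W A' c s s' t := by
  induction h with
  | skip s => exact .skip s
  | setW s x i e hi he => exact .setW s x i e hi he
  | const s v k hv hk => exact .const s v k hv (hA hk)
  | copy s v u hv hu h => exact .copy s v u hv hu (hA h)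
  | op s o v u₁ u₂ hv hu₁ hu₂ h => exact .op s o v u₁ u₂ hv hu₁ hu₂ (hA h)
  | seq _ _ hc hd => exact .seq hc hd
  | ite_true d hf hb _ hc => exact .ite_true d hf hb hc
  | ite_false c hf hb _ hd => exact .ite_false c hf hb hd
  | loop_true hf hb _ _ hc hl => exact .loop_true hf hb hc hl
  | loop_false c hf hb => exact .loop_false c hf hb

namespace Setting

variable {ℓ n m : ℕ}

/-- The test takes four steps and `skip` one. No word operation is performed and no number is
written, so `W` and `A` are arbitrary. -/
theorem main_exec_of_one (I : Setting ℓ 1 m) (W : ℕ) (A : Set ℝ) :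
    Exec W A Prog.main I.input I.input 5 := by
  have hf : (Test.weq Prog.actions (.lit 1)).Fits W I.input := ⟨trivial, trivial⟩
  exact .ite_true Prog.search hf (by simp [Test.Holds, I.ready_input.actions]) (.skip _)

theorem exists_main_exec (I : Setting ℓ n m) {G : ℕ → Set ℝ} (hG : Grading G) {B : ℕ}
    (hI : ∀ x i, I.input.num x i ∈ G B) (hn : 2 ≤ n) {W : ℕ}
    (hW : Prog.main.bound (wordBound (n ^ m) (ℓ ^ m)) ≤ W) :
    ∃ s t, Exec W (G (Prog.runGrade ℓ m B)) Prog.main I.input s t ∧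
      t ≤ Prog.main.cost (wordBound (n ^ m) (ℓ ^ m)) ∧ I.IsOptimal (output m s) := by
  have hV := room_wordBound I.types_pos hn I.outcomes_pos
  have hrun : Runs (wordBound (n ^ m) (ℓ ^ m)) (G (Prog.runGrade ℓ m B)) Prog.main I.input
      fun s => I.IsOptimal (output m s) := by
    refine .ite (fun h => ?_) fun _ => ?_
    · simp only [Test.Holds, I.ready_input.actions, WExp.eval_lit] at h
      omega
    · exact (Prog.search_runs hG hI hV I.ready_input I.holdsContract_input).conseq
        fun s _ h => Prog.isOptimal_of_search h.1 h.2
  obtain ⟨s, t, he, ht, -, hopt⟩ := hrun W hW (I.bdd_input hV)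
  exact ⟨s, t, he, ht, hopt⟩

end Setting

end BayesianPA

/-! ### The theorem -/

theorem mainTheorem7 :
    (∃ (prog : BayesianPA.Cmd) (T : MvPolynomial (Fin 2) ℕ) (Q : MvPolynomial (Fin 3) ℕ),
      ∀ (ℓ n m : ℕ) (I : BayesianPA.Setting ℓ n m),
        ∃ (s : BayesianPA.State) (t : ℕ),
          BayesianPA.Exec (T.eval ![n ^ m, ℓ ^ m]) Set.univ prog I.input s t ∧
          t ≤ T.eval ![n ^ m, ℓ ^ m] ∧
          I.IsOptimal (BayesianPA.output m s) ∧
          ∀ B : ℕ, I.DataHasBits B →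
            BayesianPA.Exec (T.eval ![n ^ m, ℓ ^ m])
              {x | BayesianPA.HasBits (Q.eval ![n ^ m, ℓ ^ m, B]) x} prog I.input s t) ∧
    ∀ (ℓ n m : ℕ) (I : BayesianPA.Setting ℓ n m),
      (∃ p ∈ I.candidates, I.IsOptimal p) ∧
      I.candidates.Finite ∧ I.candidates.ncard ≤ (ℓ * n ^ 2 + m).choose m := by
  refine ⟨?_, fun ℓ n m I =>
    ⟨I.exists_mem_candidates_isOptimal, I.candidates_finite_and_ncard_le⟩⟩
  obtain ⟨C, d, hcost⟩ := BayesianPA.Prog.main.polyBounded_cost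
  obtain ⟨C', d', hbound⟩ := BayesianPA.Prog.main.polyBounded_bound
  let P : MvPolynomial (Fin 2) ℕ := (.X 0 ^ 3 * .X 1) ^ 3 + 1
  -- The summands bound the running time, the words, and the five steps for a single action; `P` is
  -- `wordBound` plus one.
  let T : MvPolynomial (Fin 2) ℕ := .C C * P ^ d + .C C' * P ^ d' + 5
  let Q : MvPolynomial (Fin 3) ℕ :=
    1 + .X 1 * (.X 2 + (2 * (1 + .X 0 * (.X 2 + .X 0 ^ 2 * (2 * .X 2 + 2) + 2)) + 1) + 2)
  have hT : ∀ x y, T.eval ![x, y] = C * (BayesianPA.wordBound x y + 1) ^ d +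
      C' * (BayesianPA.wordBound x y + 1) ^ d' + 5 := fun x y => by
    simp [T, P, BayesianPA.wordBound]
  have hQ : ∀ x y B, Q.eval ![x, y, B] = BayesianPA.bitBound x y B := fun x y B => by
    simp [Q, BayesianPA.bitBound]
  refine ⟨BayesianPA.Prog.main, T, Q, fun ℓ n m I => ?_⟩
  simp only [hT, hQ]
  set V := BayesianPA.wordBound (n ^ m) (ℓ ^ m)
  have h1 : BayesianPA.Prog.main.cost V ≤ C * (V + 1) ^ d := hcost V
  have h2 : BayesianPA.Prog.main.bound V ≤ C' * (V + 1) ^ d' := hbound V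
  rcases (Nat.succ_le_of_lt I.actions_pos).eq_or_lt with rfl | hn
  · refine ⟨I.input, 5, I.main_exec_of_one _ _, Nat.le_add_left _ _, ?_,
      fun B _ => I.main_exec_of_one _ _⟩
    rw [I.output_input]
    exact I.isOptimal_zero_of_subsingleton
  · have hW : BayesianPA.Prog.main.bound V ≤ C * (V + 1) ^ d + C' * (V + 1) ^ d' + 5 := by omega
    obtain ⟨s, t, he, ht, hopt⟩ := I.exists_main_exec BayesianPA.Grading.univ (B := 0)
      (fun _ _ => trivial) hn hW
    refine ⟨s, t, he, (ht.trans h1).trans (by omega), hopt, fun B hB => ?_⟩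
    have hI := I.input_num_mem BayesianPA.Grading.hasBits
      (hB.2.2.1 ⟨0, I.types_pos⟩).pos hB.1 hB.2.1 hB.2.2.1 hB.2.2.2
    -- The final state must not depend on `B`. The run is obtained again with sizes controlled, and
    -- determinism shows that it is the same run.
    obtain ⟨s', t', he', -⟩ := I.exists_main_exec BayesianPA.Grading.hasBits hI hn hW
    obtain ⟨rfl, rfl⟩ := he.unique he'
    exact he'.mono fun x => BayesianPA.HasBits.mono (BayesianPA.runGrade_le hn I.outcomes_pos B)
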